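/- There is an absolute constant $C>0$ such that the following holds for every universe $V$ of nodes, every $T\ge 2$, all $\varepsilon,\delta>0$, and all integers $D\ge 1$, $W\ge 1$, $\tau\ge 0$, $k\ge 0$. Put $L:=C\cdot(\log T)^{3/2}\cdot\frac{\log(1/\delta)}{\varepsilon}$. **Inputs.** A graph sequence of length $T$ consists of finite simple undirected graphs $G_t=(V_t,E_t)$, $0\le t\le T$, with $V_t\subseteq V$, a positive integer weight for each edge where edge weights are considered, and updates $V_t=(V_{t-1}\setminus V^-_t)\cup V^+_t$, $E_t=(E_{t-1}\setminus E^-_t)\cup E^+_t$; if a node is deleted, so are all its incident edges, and both endpoints of an inserted edge lie in $V_t$. The sequence is partially dynamic if it is incremental ($V^-_t=E^-_t=\emptyset$ for all $t$) or decremental ($V^+_t=E^+_t=\emptyset$ for all $t$). **Adjacency (event level).** Two sequences of length $T$ with the same $G_0$ are edge-adjacent if, up to exchanging them, all their updates (and the weights of all other edges) agree except that one insertion, or one deletion, of a single edge $e^*$ at a single time step is missing in the second. They are node-adjacent if, up to exchanging them, one insertion, or one deletion, of a single node $v^*$ at a single time step is missing in the second, all other node updates agree, all edge updates and weights of edges not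 incident to $v^*$ agree, and in the first sequence every inserted (deleted) edge is incident to a node inserted (deleted) in the same step. **Algorithms.** An algorithm outputs at each time $t=1,\dots,T$ a real number (or vector), and the joint law of its outputs up to time $t$ is determined by $G_1,\dots,G_t$. It is $\varepsilon$-edge- (resp. $\varepsilon$-node-) differentially private if $\Pr[\mathcal A(\mathcal G)\in B]\le e^{\varepsilon}\Pr[\mathcal A(\mathcal G')\in B]$ for all edge-adjacent (resp. node-adjacent) admissible inputs $\mathcal G,\mathcal G'$ and all measurable sets $B$ of output sequences. It estimates $f$ with additive error $\alpha$ if on every admissible input, at each time $t$, its output (each coordinate of it, if $f$ is vector-valued) differs from $f(G_t)$ by at most $\alpha$ with probability at least $1-\delta$. **Claim.** For each of the following graph functions there are an $\varepsilon$-edge-differentially private algorithm and an $\varepsilon$-node-differentially private algorithm that estimate it on partially dynamic graph sequences of length $T$ with the following additive errors: | graph function | edge-private | node-private | |---|---|---| | weight of a minimum spanning tree (forest, if disconnected) | $W\cdot L$ | $DW\cdot L$ | | number of edges | $L$ | $D\cdot L$ | | number of nodes of degree at least $\tau$ | $L$ | $D\cdot L$ | | degree histogram (number of nodes of degree $j$,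 $0\le j\le D$) | $D\cdot L$ | $D^2\cdot L$ | | number of triangles | $D\cdot L$ | $D^2\cdot L$ | | number of $k$-stars (a center with $k$ distinct incident edges) | $D^k\cdot L$ | $D^k\cdot L$ | Here the admissible inputs are the partially dynamic sequences in which, wherever the bound (or the function) involves $D$, all of $G_1,\dots,G_T$ have maximum degree at most $D$ and, wherever it involves $W$, all edge weights in $G_1,\dots,G_T$ lie in $\{1,\dots,W\}$. -/

import Mathlib

open MeasureTheory

universe u

/-- A finite undirected graph with natural edge weights on a universe `V` of possible nodes.
The weight function is only meaningful on `edges`. -/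
@[ext] structure WGraph (V : Type u) where
  verts : Finset V
  edges : Finset (Sym2 V)
  weight : Sym2 V → ℕ

namespace WGraph

variable {V : Type u} [DecidableEq V]

/-- The edges incident to `v`. -/
def incident (G : WGraph V) (v : V) : Finset (Sym2 V) := {e ∈ G.edges | v ∈ e}

def degree (G : WGraph V) (v : V) : ℕ := (G.incident v).card

def edgeCount (G : WGraph V) : ℕ := G.edges.card

/-- The number of nodes of degree at least `τ`. -/
def highDegreeCount (τ : ℕ) (G : WGraph V) : ℕ := {v ∈ G.verts | τ ≤ G.degree v}.card

/-- The number of nodes of degree exactly `j`: bin `j` of the degree histogram. -/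
def degreeBin (j : ℕ) (G : WGraph V) : ℕ := {v ∈ G.verts | G.degree v = j}.card

/-- The number of sets of three pairwise adjacent nodes. -/
def triangleCount (G : WGraph V) : ℕ :=
  {s ∈ G.verts.powersetCard 3 | ∀ a ∈ s, ∀ b ∈ s, a ≠ b → s(a, b) ∈ G.edges}.card

/-- The number of `k`-stars: a center `v` together with `k` distinct edges at `v`. -/
def kStarCount (k : ℕ) (G : WGraph V) : ℕ :=
  ∑ v ∈ G.verts, ((G.incident v).powersetCard k).card

/-- `F` is the edge set of a spanning forest of `G`: it is acyclic and connects any two nodes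
that are connected in `G`. If `G` is connected, this is a spanning tree. -/
def IsSpanningForest (G : WGraph V) (F : Finset (Sym2 V)) : Prop :=
  F ⊆ G.edges ∧
  (SimpleGraph.fromEdgeSet (F : Set (Sym2 V))).IsAcyclic ∧
  ∀ a b : V, (SimpleGraph.fromEdgeSet (G.edges : Set (Sym2 V))).Reachable a b →
    (SimpleGraph.fromEdgeSet (F : Set (Sym2 V))).Reachable a b

/-- The weight of a minimum spanning tree (of a minimum spanning forest if `G` is
disconnected). -/
noncomputable def mstWeight (G : WGraph V) : ℕ :=
  sInf {x : ℕ | ∃ F : Finset (Sym2 V), G.IsSpanningForest F ∧ ∑ e ∈ F, G.weight e = x}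

end WGraph

/-- A graph sequence of length `T`: an initial graph (index `0`) and `T` updates. The update with
index `i : Fin T` leads from the graph with index `i.castSucc` to the one with index `i.succ`, so
the sequence consists of the graphs with indices `i.succ`. Every edge has a fixed weight. -/
structure GraphSeq (V : Type u) [DecidableEq V] (T : ℕ) where
  verts : Fin (T + 1) → Finset V
  edges : Fin (T + 1) → Finset (Sym2 V)
  weight : Sym2 V → ℕ
  vIns : Fin T → Finset V
  vDel : Fin T → Finset V
  eIns : Fin T → Finset (Sym2 V)
  eDel : Fin T → Finset (Sym2 V)
  edges_zero : ∀ e ∈ edges 0, ¬ e.IsDiag ∧ ∀ v ∈ e, v ∈ verts 0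
  verts_succ : ∀ i, verts i.succ = (verts i.castSucc \ vDel i) ∪ vIns i
  edges_succ : ∀ i, edges i.succ = (edges i.castSucc \ eDel i) ∪ eIns i
  /-- all edges at a deleted node are deleted -/
  eDel_of_vDel : ∀ i, ∀ v ∈ vDel i, ∀ e ∈ edges i.castSucc, v ∈ e → e ∈ eDel i
  /-- inserted edges are not loops, and both endpoints are present -/
  eIns_valid : ∀ i, ∀ e ∈ eIns i, ¬ e.IsDiag ∧ ∀ v ∈ e, v ∈ verts i.succ

namespace GraphSeq

variable {V : Type u} [DecidableEq V] {T : ℕ}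

/-- The weighted graph with index `i`; weights off its edge set are set to `0`. -/
def graph (S : GraphSeq V T) (i : Fin (T + 1)) : WGraph V where
  verts := S.verts i
  edges := S.edges i
  weight := fun e => if e ∈ S.edges i then S.weight e else 0

def Incremental (S : GraphSeq V T) : Prop := ∀ i, S.eDel i = ∅ ∧ S.vDel i = ∅

def Decremental (S : GraphSeq V T) : Prop := ∀ i, S.eIns i = ∅ ∧ S.vIns i = ∅

def PartiallyDynamic (S : GraphSeq V T) : Prop := S.Incremental ∨ S.Decremental

/-- All graphs of the sequence have maximum degree at most `D`. -/
def DegreeLE (D : ℕ) (S : GraphSeq V T) : Prop :=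
  ∀ i : Fin T, ∀ v ∈ S.verts i.succ, (S.graph i.succ).degree v ≤ D

/-- All edge weights in the sequence are in `{1, …, W}`. -/
def WeightLE (W : ℕ) (S : GraphSeq V T) : Prop :=
  ∀ i : Fin T, ∀ e ∈ S.edges i.succ, 1 ≤ S.weight e ∧ S.weight e ≤ W

/-- `A'` arises from the sequence of sets `A` by leaving out the element `x` at one time. -/
def DropsOnce {α : Type u} [DecidableEq α] (x : α) (A A' : Fin T → Finset α) : Prop :=
  (∀ t, A' t ⊆ A t) ∧ ∃ s, A s \ A' s = {x} ∧ ∀ t, t ≠ s → A t = A' t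

/-- `S` and `S'` start with the same graph, and `S'` has the updates of `S` except for one
insertion or one deletion of the edge `x`. -/
def EdgeAdjOn (x : Sym2 V) (S S' : GraphSeq V T) : Prop :=
  S.graph 0 = S'.graph 0 ∧
  (∀ e, e ≠ x → S.weight e = S'.weight e) ∧
  S.vDel = S'.vDel ∧ S.vIns = S'.vIns ∧
  ((S.eDel = S'.eDel ∧ DropsOnce x S.eIns S'.eIns) ∨
   (S.eIns = S'.eIns ∧ DropsOnce x S.eDel S'.eDel))

/-- `S` and `S'` start with the same graph, and `S'` has the updates of `S` except for one
insertion or one deletion of the node `x` and for updates of edges incident to `x`. Edge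
updates of `S` only happen together with an insertion (deletion) of an endpoint.

This includes the case that the edge update sets of `S'` are those of `S` without the edges
incident to `x`. It also allows `S'` to delete an edge `s(x, y)` if it deletes `y` while keeping
`x`, as it must since `S'` is a graph sequence. -/
def NodeAdjOn (x : V) (S S' : GraphSeq V T) : Prop :=
  S.graph 0 = S'.graph 0 ∧
  (∀ e, x ∉ e → S.weight e = S'.weight e) ∧
  ((S.vDel = S'.vDel ∧ DropsOnce x S.vIns S'.vIns) ∨
   (S.vIns = S'.vIns ∧ DropsOnce x S.vDel S'.vDel)) ∧
  (∀ t, ∀ e ∈ S.eIns t, ∃ v ∈ S.vIns t, v ∈ e) ∧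
  (∀ t, ∀ e ∈ S.eDel t, ∃ v ∈ S.vDel t, v ∈ e) ∧
  (∀ t e, x ∉ e → (e ∈ S.eIns t ↔ e ∈ S'.eIns t)) ∧
  (∀ t e, x ∉ e → (e ∈ S.eDel t ↔ e ∈ S'.eDel t))

/-- Event-level edge-adjacency. -/
def EdgeAdj (S S' : GraphSeq V T) : Prop := ∃ x, EdgeAdjOn x S S' ∨ EdgeAdjOn x S' S

/-- Event-level node-adjacency. -/
def NodeAdj (S S' : GraphSeq V T) : Prop := ∃ x, NodeAdjOn x S S' ∨ NodeAdjOn x S' S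

end GraphSeq

section Mechanism

variable {V : Type u} [DecidableEq V] {T : ℕ} {ι : Type}

/-- A randomized dynamic algorithm for sequences of length `T`, given by the joint law of its
outputs: at each of the `T` time steps it outputs a real vector with index set `ι`. -/
abbrev Mechanism (V : Type u) [DecidableEq V] (T : ℕ) (ι : Type) :=
  GraphSeq V T → ProbabilityMeasure (Fin T → ι → ℝ)

/-- The outputs are released continually: the law of the outputs up to time `t` is determined by
the graphs up to time `t`. -/
def Mechanism.Online (A : Mechanism V T ι) (P : GraphSeq V T → Prop) : Prop :=
  ∀ S S', P S → P S' → ∀ t : Fin T, (∀ i ≤ t, S.graph i.succ = S'.graph i.succ) →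
    (A S : Measure (Fin T → ι → ℝ)).map (fun o (i : Set.Iic t) => o i) =
      (A S' : Measure (Fin T → ι → ℝ)).map (fun o (i : Set.Iic t) => o i)

/-- `ε`-differential privacy on the inputs in `P`, with respect to the adjacency relation `Adj`. -/
def Mechanism.Private (A : Mechanism V T ι) (P : GraphSeq V T → Prop)
    (Adj : GraphSeq V T → GraphSeq V T → Prop) (ε : ℝ) : Prop :=
  ∀ S S', P S → P S' → Adj S S' → ∀ B : Set (Fin T → ι → ℝ), MeasurableSet B →
    (A S : Measure (Fin T → ι → ℝ)) B ≤
      ENNReal.ofReal (Real.exp ε) * (A S' : Measure (Fin T → ι → ℝ)) B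

/-- On every input in `P`, at each time step each coordinate of the output differs from that of
the graph function `f` by at most `err`, with probability at least `1 - δ`. -/
def Mechanism.Accurate (A : Mechanism V T ι) (P : GraphSeq V T → Prop)
    (f : WGraph V → ι → ℝ) (δ err : ℝ) : Prop :=
  ∀ S, P S → ∀ (t : Fin T) (j : ι),
    ENNReal.ofReal (1 - δ) ≤
      (A S : Measure (Fin T → ι → ℝ)) {o | |o t j - f (S.graph t.succ) j| ≤ err}

/-- On the partially dynamic sequences with the property `Q`, there is a dynamic algorithm for `f`
that is `ε`-differentially private with respect to `Adj` and has additive error at most `err` with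
probability at least `1 - δ`. -/
def HasPrivateAlgorithm (Q : GraphSeq V T → Prop) (Adj : GraphSeq V T → GraphSeq V T → Prop)
    (f : WGraph V → ι → ℝ) (ε δ err : ℝ) : Prop :=
  ∃ A : Mechanism V T ι,
    A.Online (fun S => S.PartiallyDynamic ∧ Q S) ∧
    A.Private (fun S => S.PartiallyDynamic ∧ Q S) Adj ε ∧
    A.Accurate (fun S => S.PartiallyDynamic ∧ Q S) f δ err

/-- A real-valued graph function as a function with a single output coordinate. -/
def scalar (f : WGraph V → ℕ) : WGraph V → Unit → ℝ := fun G _ => (f G : ℝ)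

/-- The degree histogram of a graph of maximum degree at most `D`. -/
def degreeHistogram (D : ℕ) : WGraph V → Fin (D + 1) → ℝ := fun G j => (G.degreeBin j : ℝ)

/-- The factor `log^{3/2} T · Λ` with `Λ = log (1 / δ) / ε` that all error bounds share. -/
noncomputable def baseError (T : ℕ) (ε δ : ℝ) : ℝ :=
  (Real.log T) ^ (3 / 2 : ℝ) * (Real.log (1 / δ) / ε)

end Mechanism

/-! The proof combines a mechanism for real sequences with a combinatorial estimate for graphs. Let
the variation of a sequence be its total variation when started from 0.

Mechanism (`hasPrivateAlgorithm_of_variationLE`). Suppose that on adjacent inputs the value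
sequences of f differ by a sequence of variation at most Γ. Every prefix of the time axis splits
into at most one dyadic block for each of n = O(log T) levels, and on each level the block
increments of the difference sequence have absolute sum at most Γ. Laplace noise of scale b = nΓ/ε
on every block therefore hides the difference, and a prefix carries n independent noise terms, whose
sum is of order b√n with exponential tails. This gives the error Γ · log^{3/2} T · log(1/δ)/ε unless
δ is close to 1, where log(1/δ) tends to 0. For such δ a uniform shift of size of order b√n, common
to all time steps, is added. It costs no privacy, and with it an error of at most r has probability
at least of order r/(b√n) for small r; this suffices since 1 - δ ≤ log(1/δ).

Graphs. Two edge-adjacent sequences coincide after the edge e is erased throughout, so f(G_t) -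
f(G'_t) is a difference of two effects f(H_t) - f(H_t - e). Along a partially dynamic sequence such
an effect is built from a few bounded monotone quantities, so its variation is bounded independently
of T. For nodes, the at most D edges at x in the largest graph are erased first, and then the
isolated node x (`EdgeVariationLE.nodeVariationLE`).

Spanning forests. With rank the rank in the graphic matroid, realised over the field with two
elements, the minimum weight is the sum of rank E - rank E_{≤ i} over i < W
(`mstWeight_eq_sum_rank`). Erasing e lowers a rank, by one, exactly if e is present and not spanned
by the other edges. The first condition is increasing in E and the second decreasing, so the effect
has bounded variation although it need not be monotone. -/

/-! ### Variation of real sequences -/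

/-- The sequence `h`, started from the value `0`, has total variation at most `B`. -/
def VariationLE (h : ℕ → ℝ) (B : ℝ) : Prop :=
  ∀ N, |h 0| + ∑ i ∈ Finset.range N, |h (i + 1) - h i| ≤ B

namespace VariationLE

variable {a b : ℕ → ℝ} {A B : ℝ}

theorem mono (ha : VariationLE a A) (h : A ≤ B) : VariationLE a B := fun N => (ha N).trans h

theorem zero : VariationLE (fun _ => 0) 0 := fun N => by simp

theorem add (ha : VariationLE a A) (hb : VariationLE b B) :
    VariationLE (fun t => a t + b t) (A + B) := fun N => by
  have h1 := ha N
  have h2 := hb N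
  have h3 : ∑ i ∈ Finset.range N, |a (i + 1) + b (i + 1) - (a i + b i)| ≤
      ∑ i ∈ Finset.range N, |a (i + 1) - a i| + ∑ i ∈ Finset.range N, |b (i + 1) - b i| := by
    rw [← Finset.sum_add_distrib]
    refine Finset.sum_le_sum fun i _ => ?_
    rw [add_sub_add_comm]
    exact abs_add_le _ _
  have h4 := abs_add_le (a 0) (b 0)
  linarith

theorem neg (ha : VariationLE a A) : VariationLE (fun t => -a t) A := fun N => by
  have h : ∀ i, |-a (i + 1) - -a i| = |a (i + 1) - a i| := fun i => by
    rw [neg_sub_neg, abs_sub_comm]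
  simpa only [abs_neg, h] using ha N

theorem sub (ha : VariationLE a A) (hb : VariationLE b B) :
    VariationLE (fun t => a t - b t) (A + B) := by
  simpa only [sub_eq_add_neg] using ha.add hb.neg

theorem sum {κ : Type*} (s : Finset κ) {g : κ → ℕ → ℝ} {C : κ → ℝ}
    (h : ∀ i ∈ s, VariationLE (g i) (C i)) :
    VariationLE (fun t => ∑ i ∈ s, g i t) (∑ i ∈ s, C i) := by
  classical
  induction s using Finset.induction_on with
  | empty => simpa using zero
  | insert i s hi ih =>
    simp only [Finset.sum_insert hi]
    exact (h i (by simp)).add (ih fun j hj => h j (by simp [hj]))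

/-- A monotone sequence in [0, A] moves by at most A in total; the second A pays for the jump from 0
to its first value. -/
theorem of_monotone_or_antitone (h : Monotone a ∨ Antitone a) (h0 : ∀ t, 0 ≤ a t)
    (hA : ∀ t, a t ≤ A) : VariationLE a (2 * A) := fun N => by
  have key : ∑ i ∈ Finset.range N, |a (i + 1) - a i| ≤ |a N - a 0| := by
    rcases h with h | h
    · rw [Finset.sum_congr rfl fun i _ => abs_of_nonneg (sub_nonneg.2 (h i.le_succ)),
        Finset.sum_range_sub]
      exact le_abs_self _
    · rw [Finset.sum_congr rfl fun i _ => abs_of_nonpos (sub_nonpos.2 (h i.le_succ)),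
        Finset.sum_neg_distrib, Finset.sum_range_sub]
      exact neg_le_abs _
  have h1 : |a N - a 0| ≤ A := abs_le.2 ⟨by linarith [h0 N, hA 0], by linarith [h0 0, hA N]⟩
  rw [abs_of_nonneg (h0 0)]
  linarith [hA 0]

theorem indicator {p : ℕ → Prop} [DecidablePred p] (h : Monotone p ∨ Antitone p) :
    VariationLE (fun t => if p t then 1 else 0) 2 := by
  rw [← mul_one (2 : ℝ)]
  refine of_monotone_or_antitone (h.imp ?_ ?_) (fun t => by split_ifs <;> simp)
    fun t => by split_ifs <;> simp
  all_goals
    intro h s t hst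
    have := h hst
    dsimp only
    split_ifs with h1 h2 <;> simp
    tauto

/-- Serves for the product of an increasing and a decreasing indicator, which need not be monotone.
-/
theorem mul (ha : VariationLE a A) (hb : VariationLE b B) (ha1 : ∀ t, |a t| ≤ 1)
    (hb1 : ∀ t, |b t| ≤ 1) : VariationLE (fun t => a t * b t) (A + B) := fun N => by
  have h1 := ha N
  have h2 := hb N
  have h3 : ∑ i ∈ Finset.range N, |a (i + 1) * b (i + 1) - a i * b i| ≤
      ∑ i ∈ Finset.range N, |a (i + 1) - a i| + ∑ i ∈ Finset.range N, |b (i + 1) - b i| := by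
    rw [← Finset.sum_add_distrib]
    refine Finset.sum_le_sum fun i _ => ?_
    have : a (i + 1) * b (i + 1) - a i * b i =
      (a (i + 1) - a i) * b (i + 1) + a i * (b (i + 1) - b i) := by ring
    rw [this]
    refine (abs_add_le _ _).trans ?_
    rw [abs_mul, abs_mul]
    exact add_le_add (mul_le_of_le_one_right (abs_nonneg _) (hb1 _))
      (mul_le_of_le_one_left (abs_nonneg _) (ha1 _))
  have h4 : |a 0 * b 0| ≤ |a 0| := by
    rw [abs_mul]
    exact mul_le_of_le_one_right (abs_nonneg _) (hb1 _)
  linarith [abs_nonneg (b 0)]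

end VariationLE

/-! ### Laplace noise -/

section Laplace

theorem integrable_exp_mul_sub_abs {s : ℝ} (hs : |s| < 1) :
    Integrable fun x : ℝ => Real.exp (s * x - |x|) := by
  obtain ⟨h1, h2⟩ := abs_lt.1 hs
  rw [← integrableOn_univ, ← Set.Iic_union_Ioi (a := (0 : ℝ)), integrableOn_union]
  constructor
  · refine (integrableOn_exp_mul_Iic (a := s + 1) (by linarith) 0).congr_fun (fun x hx => ?_)
      measurableSet_Iic
    simp only [abs_of_nonpos (Set.mem_Iic.1 hx)]
    ring_nf
  · refine (integrableOn_exp_mul_Ioi (a := s - 1) (by linarith) 0).congr_fun (fun x hx => ?_)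
      measurableSet_Ioi
    simp only [abs_of_pos (Set.mem_Ioi.1 hx)]
    ring_nf

theorem integral_exp_mul_sub_abs {s : ℝ} (hs : |s| < 1) :
    ∫ x : ℝ, Real.exp (s * x - |x|) = 2 / (1 - s ^ 2) := by
  obtain ⟨h1, h2⟩ := abs_lt.1 hs
  have hi := integrable_exp_mul_sub_abs hs
  rw [← setIntegral_univ, ← Set.Iic_union_Ioi (a := (0 : ℝ)),
    setIntegral_union (Set.Iic_disjoint_Ioi le_rfl) measurableSet_Ioi hi.integrableOn
      hi.integrableOn,
    setIntegral_congr_fun (g := fun x => Real.exp ((s + 1) * x)) measurableSet_Iic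
      (fun x hx => by
        simp only [abs_of_nonpos (Set.mem_Iic.1 hx)]
        ring_nf),
    setIntegral_congr_fun (g := fun x => Real.exp ((s - 1) * x)) measurableSet_Ioi
      (fun x hx => by
        simp only [abs_of_pos (Set.mem_Ioi.1 hx)]
        ring_nf),
    integral_exp_mul_Iic (by linarith), integral_exp_mul_Ioi (by linarith)]
  have h3 : s + 1 ≠ 0 := by linarith
  have h4 : s - 1 ≠ 0 := by linarith
  have h5 : 1 - s ^ 2 ≠ 0 := by
    have : 1 - s ^ 2 = -((s + 1) * (s - 1)) := by ring
    rw [this]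
    exact neg_ne_zero.2 (mul_ne_zero h3 h4)
  simp only [mul_zero, Real.exp_zero]
  field_simp
  ring

variable (K : Type*) [Fintype K]

/-- The law of a vector of independent Laplace variables of scale `1`. -/
noncomputable def laplaceNoise : Measure (K → ℝ) :=
  volume.withDensity fun z => ENNReal.ofReal (∏ k, (1 / 2 * Real.exp (-|z k|)))

variable {K}

theorem lintegral_exp_laplaceNoise (c : K → ℝ) (hc : ∀ k, |c k| < 1) :
    ∫⁻ z, ENNReal.ofReal (Real.exp (∑ k, c k * z k)) ∂laplaceNoise K =
      ENNReal.ofReal (∏ k, (1 / (1 - c k ^ 2))) := by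
  rw [laplaceNoise, lintegral_withDensity_eq_lintegral_mul _ (by fun_prop) (by fun_prop)]
  have h : ∀ z : K → ℝ, ((fun z : K → ℝ => ENNReal.ofReal (∏ k, (1 / 2 * Real.exp (-|z k|)))) *
      fun z : K → ℝ => ENNReal.ofReal (Real.exp (∑ k, c k * z k))) z =
      ENNReal.ofReal (∏ k, (1 / 2 * Real.exp (c k * z k - |z k|))) := by
    intro z
    simp only [Pi.mul_apply]
    rw [← ENNReal.ofReal_mul (by positivity), Real.exp_sum, ← Finset.prod_mul_distrib]
    congr 1
    refine Finset.prod_congr rfl fun k _ => ?_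
    rw [mul_assoc, ← Real.exp_add]
    ring_nf
  simp_rw [h]
  have hi : Integrable (fun z : K → ℝ => ∏ k, (1 / 2 * Real.exp (c k * z k - |z k|))) volume :=
    Integrable.fintype_prod_dep (f := fun k x => 1 / 2 * Real.exp (c k * x - |x|))
      fun k => (integrable_exp_mul_sub_abs (hc k)).const_mul (1 / 2)
  rw [← ofReal_integral_eq_lintegral_ofReal hi
    (Filter.Eventually.of_forall fun z => by positivity),
    integral_fintype_prod_volume_eq_prod (f := fun k x => 1 / 2 * Real.exp (c k * x - |x|))]
  congr 1
  refine Finset.prod_congr rfl fun k _ => ?_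
  rw [integral_const_mul, integral_exp_mul_sub_abs (hc k)]
  ring

instance : IsProbabilityMeasure (laplaceNoise K) := ⟨by
  have := lintegral_exp_laplaceNoise (K := K) (fun _ => 0) (by simp)
  simpa using this⟩

/-- By the triangle inequality in each exponent, translation by `a` changes the density by a factor
of at most exp(∑ |a k|). -/
theorem laplaceNoise_preimage_add_le (a : K → ℝ) {A : Set (K → ℝ)} (hA : MeasurableSet A) :
    laplaceNoise K ((fun z => z + a) ⁻¹' A) ≤
      ENNReal.ofReal (Real.exp (∑ k, |a k|)) * laplaceNoise K A := by
  have hA' : MeasurableSet ((fun z => z + a) ⁻¹' A) := hA.preimage (by fun_prop)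
  rw [laplaceNoise, withDensity_apply _ hA, withDensity_apply _ hA', ← lintegral_indicator hA,
    ← lintegral_indicator hA', ← lintegral_const_mul _ (Measurable.indicator (by fun_prop) hA),
    ← lintegral_add_right_eq_self (fun z => ENNReal.ofReal (Real.exp (∑ k, |a k|)) * _) a]
  refine lintegral_mono fun z => ?_
  by_cases hz : z + a ∈ A
  · rw [Set.indicator_of_mem (s := (fun z => z + a) ⁻¹' A) hz, Set.indicator_of_mem hz,
      ← ENNReal.ofReal_mul (by positivity), Real.exp_sum, ← Finset.prod_mul_distrib]
    refine ENNReal.ofReal_le_ofReal (Finset.prod_le_prod (fun _ _ => by positivity) fun k _ => ?_)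
    rw [mul_left_comm, ← Real.exp_add]
    gcongr
    have := abs_sub_abs_le_abs_sub (z k + a k) (z k)
    rw [add_sub_cancel_left] at this
    simp only [Pi.add_apply]
    linarith
  · rw [Set.indicator_of_notMem (s := (fun z => z + a) ⁻¹' A) hz]
    exact zero_le

theorem one_div_one_sub_le_exp {x : ℝ} (h0 : 0 ≤ x) (h1 : x ≤ 1 / 2) :
    1 / (1 - x) ≤ Real.exp (2 * x) := by
  rw [div_le_iff₀ (by linarith)]
  have := Real.add_one_le_exp (2 * x)
  nlinarith

/-- With m = `s.card`, the number |r| = 1/√(2m) is the inverse standard deviation of the sum. Each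
of the m factors 1/(1 - r²) of the moment generating function is at most exp(2r²) = exp(1/m). -/
theorem lintegral_exp_mul_sum_laplaceNoise_le (s : Finset K) (hs : s.Nonempty) {r : ℝ}
    (hr : 2 * s.card * r ^ 2 = 1) :
    ∫⁻ z, ENNReal.ofReal (Real.exp (r * ∑ k ∈ s, z k)) ∂laplaceNoise K ≤
      ENNReal.ofReal (Real.exp 1) := by
  classical
  have hcard : (1 : ℝ) ≤ s.card := by exact_mod_cast hs.card_pos
  have hr2 : r ^ 2 ≤ 1 / 2 := by nlinarith [sq_nonneg r]
  have hr1 : |r| < 1 := by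
    rw [← sq_lt_one_iff_abs_lt_one]
    linarith
  have h := lintegral_exp_laplaceNoise (fun k => if k ∈ s then r else 0)
    (fun k => by split_ifs <;> simp [hr1])
  have h2 : ∀ z : K → ℝ, ∑ k, (if k ∈ s then r else 0) * z k = r * ∑ k ∈ s, z k := fun z => by
    simp [Finset.mul_sum, ite_mul, Finset.sum_ite_mem]
  simp_rw [h2] at h
  rw [h]
  refine ENNReal.ofReal_le_ofReal ?_
  have h3 : ∀ k, (1 / (1 - (if k ∈ s then r else 0) ^ 2)) =
      if k ∈ s then 1 / (1 - r ^ 2) else 1 := fun k => by split_ifs <;> simp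
  simp_rw [h3]
  rw [Finset.prod_ite_mem, Finset.univ_inter, Finset.prod_const]
  calc (1 / (1 - r ^ 2)) ^ s.card ≤ Real.exp (2 * r ^ 2) ^ s.card := by
        have : 0 ≤ 1 / (1 - r ^ 2) := by
          apply div_nonneg <;> linarith
        gcongr
        exact one_div_one_sub_le_exp (sq_nonneg r) hr2
    _ = Real.exp 1 := by
        rw [← Real.exp_nat_mul]
        congr 1
        linarith

/-- Markov's inequality for exp(S/w) + exp(-S/w), where S is the sum and w its standard deviation;
the expectation is at most 2e. -/
theorem laplaceNoise_tail (s : Finset K) (hs : s.Nonempty) (y : ℝ) :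
    laplaceNoise K {z | √(2 * s.card) * y ≤ |∑ k ∈ s, z k|} ≤
      ENNReal.ofReal (2 * Real.exp (1 - y)) := by
  have hcard : (0 : ℝ) < 2 * s.card := by
    have : (0 : ℝ) < s.card := by exact_mod_cast hs.card_pos
    linarith
  set w := √(2 * s.card) with hw
  have hw0 : 0 < w := Real.sqrt_pos.2 hcard
  have hw2 : w ^ 2 = 2 * s.card := Real.sq_sqrt hcard.le
  have hr : 2 * s.card * w⁻¹ ^ 2 = 1 := by
    rw [← hw2]
    field_simp
  have hr' : 2 * s.card * (-w⁻¹) ^ 2 = 1 := by rw [neg_sq, hr]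
  have hI := add_le_add (lintegral_exp_mul_sum_laplaceNoise_le s hs hr)
    (lintegral_exp_mul_sum_laplaceNoise_le s hs hr')
  rw [← lintegral_add_left (by fun_prop), ← ENNReal.ofReal_add (by positivity) (by positivity)]
    at hI
  have hM := meas_ge_le_lintegral_div (μ := laplaceNoise K) (f := fun z : K → ℝ =>
      ENNReal.ofReal (Real.exp (w⁻¹ * ∑ k ∈ s, z k)) +
      ENNReal.ofReal (Real.exp (-w⁻¹ * ∑ k ∈ s, z k))) (by fun_prop)
    (ε := ENNReal.ofReal (Real.exp y)) (by simp [Real.exp_pos]) (by simp)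
  refine (measure_mono fun z hz => ?_).trans (hM.trans ((ENNReal.div_le_div_right hI _).trans ?_))
  · simp only [Set.mem_ofPred_eq] at hz ⊢
    rw [← ENNReal.ofReal_add (by positivity) (by positivity)]
    refine ENNReal.ofReal_le_ofReal ?_
    have hy : y ≤ w⁻¹ * |∑ k ∈ s, z k| := by
      rw [← div_eq_inv_mul, le_div_iff₀ hw0]
      linarith
    rcases abs_cases (∑ k ∈ s, z k) with h | h
    · rw [h.1] at hy
      linarith [Real.exp_le_exp.2 hy, Real.exp_pos (-w⁻¹ * ∑ k ∈ s, z k)]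
    · rw [h.1, mul_neg, ← neg_mul] at hy
      linarith [Real.exp_le_exp.2 hy, Real.exp_pos (w⁻¹ * ∑ k ∈ s, z k)]
  · rw [← ENNReal.ofReal_div_of_pos (Real.exp_pos _), ← two_mul, mul_div_assoc, ← Real.exp_sub]

end Laplace

/-! ### Dyadic decomposition of prefixes -/

section Dyadic

variable {ι : Type} (n T : ℕ)

/-- The dyadic intervals, for each output coordinate: `(l, q, j)` stands for the `q`-th block of
level `l`. -/
abbrev DyadicIndex (ι : Type) := Fin n × Fin (T + 1) × ι

/-- The blocks that the prefix ending with time step `t` uses. -/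
def dyadicPath (t : Fin T) (j : ι) (l : Fin n) : DyadicIndex n T ι :=
  (l, ⟨(t + 1) / 2 ^ (l : ℕ), Nat.lt_succ_of_le ((Nat.div_le_self _ _).trans t.2)⟩, j)

theorem dyadicPath_injective (t : Fin T) (j : ι) : Function.Injective (dyadicPath n T t j) :=
  fun _ _ h => congrArg Prod.fst h

/-- The increment of `F` on a dyadic block. -/
def dyadicIncrement (F : ℕ → ι → ℝ) (k : DyadicIndex n T ι) : ℝ :=
  F (k.2.1 * 2 ^ (k.1 : ℕ)) k.2.2 - F (k.2.1 / 2 * 2 ^ (k.1 + 1 : ℕ)) k.2.2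

variable {n T}

/-- The increments telescope along the levels, since halving the block number moves up one level; `T
< 2 ^ n` makes the last term F 0. -/
theorem sum_dyadicIncrement (F : ℕ → ι → ℝ) (h0 : ∀ j, F 0 j = 0) (hT : T < 2 ^ n) (t : Fin T)
    (j : ι) : ∑ l, dyadicIncrement n T F (dyadicPath n T t j l) = F (t + 1) j := by
  simp only [dyadicIncrement, dyadicPath, Nat.div_div_eq_div_mul,
    ← pow_succ]
  rw [Fin.sum_univ_eq_sum_range (fun l => F ((t + 1) / 2 ^ l * 2 ^ l) j -
    F ((t + 1) / 2 ^ (l + 1) * 2 ^ (l + 1)) j), Finset.sum_range_sub']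
  have : ((t : ℕ) + 1) / 2 ^ n = 0 := Nat.div_eq_of_lt (by omega)
  simp [this, h0]

theorem sum_abs_sub_block_le (g : ℕ → ℝ) (m N : ℕ) :
    ∑ q ∈ Finset.range N, |g ((q + 1) * m) - g (q * m)| ≤
      ∑ i ∈ Finset.range (N * m), |g (i + 1) - g i| := by
  induction N with
  | zero => simp
  | succ N ih =>
    rw [Finset.sum_range_succ, Nat.succ_mul, Finset.sum_range_add]
    refine add_le_add ih ?_
    have := Finset.sum_range_sub (fun i => g (N * m + i)) m
    rw [add_zero] at this
    rw [← this]
    exact Finset.abs_sum_le_sum_abs _ _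

/-- On one level, blocks with odd number give increments over disjoint intervals and those with even
number give 0, so each level costs at most the variation. -/
theorem sum_abs_dyadicIncrement_le [Fintype ι] (F : ℕ → ι → ℝ) (h0 : ∀ j, F 0 j = 0) {B : ι → ℝ}
    (hB : ∀ j, VariationLE (fun t => F (t + 1) j) (B j)) :
    ∑ k, |dyadicIncrement n T F k| ≤ n * ∑ j, B j := by
  have key : ∀ (l : Fin n) (j : ι),
      ∑ q : Fin (T + 1), |dyadicIncrement n T F (l, q, j)| ≤ B j := by
    intro l j
    have hB0 : ∀ N, ∑ i ∈ Finset.range N, |F (i + 1) j - F i j| ≤ B j := by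
      intro N
      cases N with
      | zero => simpa using (abs_nonneg _).trans (by simpa using hB j 0)
      | succ N =>
        rw [Finset.sum_range_succ', add_comm]
        simpa [h0] using hB j N
    simp only [dyadicIncrement]
    rw [Fin.sum_univ_eq_sum_range (fun q => |F (q * 2 ^ (l : ℕ)) j -
      F (q / 2 * 2 ^ (l + 1 : ℕ)) j|), Finset.sum_range_succ']
    simp only [zero_mul, Nat.zero_div, sub_self, abs_zero, add_zero]
    refine le_trans (Finset.sum_le_sum fun q _ => ?_)
      ((sum_abs_sub_block_le (fun i => F i j) (2 ^ (l : ℕ)) T).trans (hB0 _))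
    -- The block number is q + 1, since block 0 has been split off: it is odd in the first case, and
    -- in the second the increment vanishes.
    rcases Nat.even_or_odd' q with ⟨c, rfl | rfl⟩
    · have : (2 * c + 1) / 2 * 2 ^ (l + 1 : ℕ) = 2 * c * 2 ^ (l : ℕ) := by
        rw [show (2 * c + 1) / 2 = c by omega]
        ring
      rw [this]
    · have : (2 * c + 1 + 1) / 2 * 2 ^ (l + 1 : ℕ) = (2 * c + 1 + 1) * 2 ^ (l : ℕ) := by
        rw [show (2 * c + 1 + 1) / 2 = c + 1 by omega]
        ring
      rw [this, sub_self, abs_zero]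
      exact abs_nonneg _
  rw [Fintype.sum_prod_type]
  refine (Finset.sum_le_sum (g := fun _ => ∑ j, B j) fun l _ => ?_).trans (by simp)
  rw [Fintype.sum_prod_type, Finset.sum_comm]
  exact Finset.sum_le_sum fun j _ => key l j

end Dyadic

/-! ### The tree mechanism -/

section Mechanism

/-- By `h` the interval of radius r around -x lies inside [-M, M], so the uniform law gives it its
full share r/M. -/
theorem cond_Icc_translate {M x r : ℝ} (hM : 0 < M) (h : |x| + r ≤ M) :
    ProbabilityTheory.cond volume (Set.Icc (-M) M) {u : ℝ | |x + u| ≤ r} =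
      ENNReal.ofReal (r / M) := by
  have hs : Set.Icc (-M) M ∩ {u : ℝ | |x + u| ≤ r} = Set.Icc (-x - r) (-x + r) := by
    ext u
    have h1 := le_abs_self x
    have h2 := neg_abs_le x
    simp only [Set.mem_inter_iff, Set.mem_Icc, Set.mem_ofPred_eq, abs_le]
    constructor
    · rintro ⟨_, _, _⟩
      constructor <;> linarith
    · rintro ⟨_, _⟩
      refine ⟨⟨?_, ?_⟩, ?_, ?_⟩ <;> linarith
  rw [ProbabilityTheory.cond_apply measurableSet_Icc, hs, Real.volume_Icc, Real.volume_Icc,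
    ← ENNReal.ofReal_inv_of_pos (by linarith), ← ENNReal.ofReal_mul (by
      rw [inv_nonneg]; linarith)]
  congr 1
  field_simp
  ring

variable {ι : Type} (n T : ℕ) (b M : ℝ)

/-- The output of the tree mechanism at the noise values `w`. -/
def treeOutput (F : ℕ → ι → ℝ) (w : (DyadicIndex n T ι → ℝ) × ℝ) : Fin T → ι → ℝ :=
  fun t j => F (t + 1) j + b * ∑ l, w.1 (dyadicPath n T t j l) + w.2

/-- The joint law of the noise: Laplace noise for each dyadic block, and a uniform shift. -/
noncomputable def treeNoise (ι : Type) [Fintype ι] : Measure ((DyadicIndex n T ι → ℝ) × ℝ) :=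
  (laplaceNoise (DyadicIndex n T ι)).prod (ProbabilityTheory.cond volume (Set.Icc (-M) M))

variable {n T b M}

theorem measurable_treeOutput (F : ℕ → ι → ℝ) : Measurable (treeOutput n T b F) := by
  unfold treeOutput
  fun_prop

theorem isProbabilityMeasure_cond_Icc (hM : 0 < M) :
    IsProbabilityMeasure (ProbabilityTheory.cond (volume : Measure ℝ) (Set.Icc (-M) M)) :=
  ProbabilityTheory.cond_isProbabilityMeasure_of_finite
    (by rw [Real.volume_Icc]; simpa using by linarith) (by rw [Real.volume_Icc]; simp)

variable [Fintype ι]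

/-- Privacy of the tree mechanism. -/
theorem map_treeOutput_le (hM : 0 < M) (hb : 0 < b) (hT : T < 2 ^ n) {F F' : ℕ → ι → ℝ}
    (h0 : ∀ j, F 0 j = 0) (h0' : ∀ j, F' 0 j = 0) {B : ι → ℝ}
    (hB : ∀ j, VariationLE (fun t => F (t + 1) j - F' (t + 1) j) (B j)) {ε : ℝ}
    (hε : n * ∑ j, B j ≤ b * ε) {E : Set (Fin T → ι → ℝ)} (hE : MeasurableSet E) :
    (treeNoise n T M ι).map (treeOutput n T b F) E ≤
      ENNReal.ofReal (Real.exp ε) * (treeNoise n T M ι).map (treeOutput n T b F') E := by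
  have := isProbabilityMeasure_cond_Icc hM
  rw [Measure.map_apply (measurable_treeOutput F) hE,
    Measure.map_apply (measurable_treeOutput F') hE, treeNoise,
    Measure.prod_apply_symm (measurable_treeOutput F hE),
    Measure.prod_apply_symm (measurable_treeOutput F' hE),
    ← lintegral_const_mul _ (measurable_measure_prodMk_right (measurable_treeOutput F' hE))]
  refine lintegral_mono fun u => ?_
  -- For a fixed shift u, translating the Laplace noise by the scaled increments of F - F' turns the
  -- output for F' into that for F.
  set a : DyadicIndex n T ι → ℝ :=
    fun k => b⁻¹ * dyadicIncrement n T (fun t j => F t j - F' t j) k with ha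
  have hset : (fun x => (x, u)) ⁻¹' (treeOutput n T b F ⁻¹' E) =
      (fun z => z + a) ⁻¹' ((fun x => (x, u)) ⁻¹' (treeOutput n T b F' ⁻¹' E)) := by
    ext z
    simp only [Set.mem_preimage]
    suffices treeOutput n T b F (z, u) = treeOutput n T b F' (z + a, u) by rw [this]
    funext t j
    have hs := sum_dyadicIncrement (fun t j => F t j - F' t j) (by simp [h0, h0']) hT t j
    simp only [treeOutput, Pi.add_apply, Finset.sum_add_distrib, ha]
    rw [← Finset.mul_sum, hs, mul_add, mul_inv_cancel_left₀ hb.ne']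
    ring
  rw [hset]
  refine (laplaceNoise_preimage_add_le a
    (measurable_prodMk_right (measurable_treeOutput F' hE))).trans ?_
  gcongr
  have hsum := sum_abs_dyadicIncrement_le (n := n) (T := T) (fun t j => F t j - F' t j)
    (by simp [h0, h0']) hB
  simp only [ha, abs_mul, abs_of_pos (inv_pos.2 hb)]
  rw [← Finset.mul_sum, inv_mul_le_iff₀ hb]
  exact hsum.trans hε

theorem laplaceNoise_path_tail (hn : 0 < n) (hb : 0 < b) (t : Fin T) (j : ι) (y : ℝ) :
    ENNReal.ofReal (1 - 2 * Real.exp (1 - y)) ≤ laplaceNoise (DyadicIndex n T ι)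
      {z | |b * ∑ l, z (dyadicPath n T t j l)| ≤ b * √(2 * n) * y} := by
  have hne : (Finset.univ : Finset (Fin n)).Nonempty := ⟨⟨0, hn⟩, Finset.mem_univ _⟩
  have h := laplaceNoise_tail
    (Finset.univ.map ⟨dyadicPath n T t j, dyadicPath_injective n T t j⟩) (by simpa using hne) y
  simp only [Finset.sum_map, Function.Embedding.coeFn_mk, Finset.card_map, Finset.card_univ,
    Fintype.card_fin] at h
  have hm : MeasurableSet {z : DyadicIndex n T ι → ℝ |
      √(2 * n) * y ≤ |∑ l, z (dyadicPath n T t j l)|} :=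
    measurableSet_le (by fun_prop) (by fun_prop)
  rw [ENNReal.ofReal_sub _ (by positivity), ENNReal.ofReal_one]
  refine (tsub_le_tsub_left h 1).trans ?_
  rw [← prob_compl_eq_one_sub hm]
  refine measure_mono fun z hz => ?_
  simp only [Set.mem_compl_iff, Set.mem_ofPred_eq, not_le] at hz ⊢
  rw [abs_mul, abs_of_pos hb, mul_assoc]
  exact mul_le_mul_of_nonneg_left hz.le hb.le

/-- Accuracy of the tree mechanism for small failure probabilities. -/
theorem treeNoise_tail (hn : 0 < n) (hb : 0 < b) (hM : 0 < M) (t : Fin T) (j : ι) (y : ℝ) :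
    ENNReal.ofReal (1 - 2 * Real.exp (1 - y)) ≤ treeNoise n T M ι
      {w | |b * ∑ l, w.1 (dyadicPath n T t j l) + w.2| ≤ b * √(2 * n) * y + M} := by
  have hprob := isProbabilityMeasure_cond_Icc hM
  refine (laplaceNoise_path_tail hn hb t j y).trans ?_
  have hI : ProbabilityTheory.cond (volume : Measure ℝ) (Set.Icc (-M) M) (Set.Icc (-M) M) = 1 :=
    ProbabilityTheory.cond_apply_self (by rw [Real.volume_Icc]; simpa using by linarith)
      (by rw [Real.volume_Icc]; simp)
  rw [← mul_one (laplaceNoise _ _), ← hI, ← Measure.prod_prod]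
  refine measure_mono ?_
  rintro ⟨z, u⟩ ⟨hz, hu⟩
  simp only [Set.mem_ofPred_eq] at hz hu ⊢
  exact (abs_add_le _ _).trans (add_le_add hz (abs_le.2 hu))

/-- Accuracy of the tree mechanism for failure probabilities close to `1`. -/
theorem treeNoise_concentration (hn : 0 < n) (hb : 0 < b) (t : Fin T) (j : ι)
    (hM : M = 6 * (b * √(2 * n))) {r : ℝ} (hr0 : 0 ≤ r) (hr : r ≤ M / 2) :
    ENNReal.ofReal (r / (2 * M)) ≤ treeNoise n T M ι
      {w | |b * ∑ l, w.1 (dyadicPath n T t j l) + w.2| ≤ r} := by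
  have hn' : (0 : ℝ) < n := by exact_mod_cast hn
  have hM0 : 0 < M := by rw [hM]; positivity
  have hprob := isProbabilityMeasure_cond_Icc hM0
  have h := laplaceNoise_path_tail hn hb t j 3
  have hm : MeasurableSet {w : (DyadicIndex n T ι → ℝ) × ℝ |
      |b * ∑ l, w.1 (dyadicPath n T t j l) + w.2| ≤ r} :=
    measurableSet_le (by fun_prop) (by fun_prop)
  have hm' : MeasurableSet {z : DyadicIndex n T ι → ℝ |
      |b * ∑ l, z (dyadicPath n T t j l)| ≤ b * √(2 * n) * 3} :=
    measurableSet_le (by fun_prop) (by fun_prop)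
  rw [treeNoise, Measure.prod_apply hm]
  -- Restrict to the event that the Laplace part is at most M/2 = 3b√(2n), of probability at least 1
  -- - 2e⁻² ≥ 1/2. There the independent shift brings the total within r with probability r/M.
  refine le_trans ?_ (setLIntegral_le_lintegral
    {z | |b * ∑ l, z (dyadicPath n T t j l)| ≤ b * √(2 * n) * 3} _)
  have hle : ∀ z ∈ {z : DyadicIndex n T ι → ℝ |
      |b * ∑ l, z (dyadicPath n T t j l)| ≤ b * √(2 * n) * 3}, ENNReal.ofReal (r / M) ≤
      ProbabilityTheory.cond volume (Set.Icc (-M) M) (Prod.mk z ⁻¹'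
        {w : (DyadicIndex n T ι → ℝ) × ℝ |
          |b * ∑ l, w.1 (dyadicPath n T t j l) + w.2| ≤ r}) := by
    intro z hz
    refine (cond_Icc_translate hM0 (x := b * ∑ l, z (dyadicPath n T t j l)) ?_).ge
    simp only [Set.mem_ofPred_eq] at hz
    linarith
  refine le_trans ?_ (setLIntegral_mono' hm' hle)
  rw [setLIntegral_const]
  refine le_trans ?_ (mul_le_mul_right h _)
  rw [← ENNReal.ofReal_mul (by positivity)]
  refine ENNReal.ofReal_le_ofReal ?_
  have he : Real.exp (1 - 3) ≤ 1 / 4 := by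
    rw [show (1 - 3 : ℝ) = -(1 + 1) by norm_num, Real.exp_neg, Real.exp_add]
    have := Real.add_one_le_exp 1
    rw [inv_le_comm₀ (by positivity) (by norm_num)]
    nlinarith
  have hrM : 0 ≤ r / M := by positivity
  calc r / (2 * M) = r / M * (1 / 2) := by field_simp
    _ ≤ _ := by
      gcongr
      linarith

end Mechanism

/-! ### From bounded variation to private algorithms -/

section Existence

variable {V : Type u} [DecidableEq V] {T : ℕ}

/-- The graph after `t + 1` updates (the final graph if there are not so many). -/
def GraphSeq.graphAt (S : GraphSeq V T) (t : ℕ) : WGraph V :=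
  S.graph ⟨min (t + 1) T, by omega⟩

theorem GraphSeq.graphAt_eq (S : GraphSeq V T) (t : Fin T) : S.graphAt t = S.graph t.succ := by
  have : (⟨min (t + 1) T, by omega⟩ : Fin (T + 1)) = t.succ := Fin.ext (by simp)
  rw [GraphSeq.graphAt, this]

/-- As T ≥ 2, the left side is at most 2⌊log₂ T⌋ ≤ (2 / log 2) log T, and 2 / log 2 < 3. -/
theorem natLog_add_one_le (hT : 2 ≤ T) : ((Nat.log 2 T + 1 : ℕ) : ℝ) ≤ 3 * Real.log T := by
  have h1 : 1 ≤ Nat.log 2 T :=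
    (Nat.le_log_iff_pow_le (by norm_num) (by omega)).2 (by simpa using hT)
  have h2 : ((2 : ℝ) ^ Nat.log 2 T) ≤ T := by
    exact_mod_cast Nat.pow_log_le_self 2 (by omega)
  have h3 := Real.log_le_log (by positivity) h2
  rw [Real.log_pow] at h3
  have h4 := Real.log_two_gt_d9
  have h5 : (1 : ℝ) ≤ Nat.log 2 T := by exact_mod_cast h1
  push_cast
  nlinarith

theorem mul_sqrt_le_rpow {m x : ℝ} (hm : 0 ≤ m) (h : m ≤ 3 * x) :
    m * √(2 * m) ≤ 8 * x ^ (3 / 2 : ℝ) := by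
  have hx : 0 ≤ x := by linarith
  have h1 : x ^ (3 / 2 : ℝ) = x * √x := by
    rw [show (3 / 2 : ℝ) = 1 + 1 / 2 by norm_num, Real.rpow_add_of_nonneg hx (by norm_num)
      (by norm_num), Real.rpow_one, Real.sqrt_eq_rpow]
  have h2 : √(2 * m) ≤ 5 / 2 * √x := by
    rw [Real.sqrt_le_left (by positivity), mul_pow, Real.sq_sqrt hx]
    linarith
  rw [h1]
  calc m * √(2 * m) ≤ 3 * x * (5 / 2 * √x) := by gcongr
    _ ≤ 8 * (x * √x) := by nlinarith [mul_nonneg hx (Real.sqrt_nonneg x)]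

variable {ι : Type}

/-- A constant output is a private algorithm if no accuracy is required. -/
theorem hasPrivateAlgorithm_of_one_le (Q : GraphSeq V T → Prop)
    (Adj : GraphSeq V T → GraphSeq V T → Prop) (f : WGraph V → ι → ℝ) {ε δ : ℝ} (err : ℝ)
    (hε : 0 ≤ ε) (hδ : 1 ≤ δ) : HasPrivateAlgorithm Q Adj f ε δ err := by
  refine ⟨fun _ => ⟨Measure.dirac 0, inferInstance⟩, fun _ _ _ _ _ _ => rfl, ?_, ?_⟩
  · intro S S' _ _ _ B _
    refine le_mul_of_one_le_left zero_le ?_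
    rw [ENNReal.one_le_ofReal]
    exact Real.one_le_exp hε
  · intro S _ t j
    rw [ENNReal.ofReal_of_nonpos (by linarith)]
    exact zero_le

variable [Fintype ι]

/-- If on adjacent inputs the sequences of values of `f` differ by a sequence of variation at most
`Γ`, then `f` can be estimated privately with error proportional to `Γ`. -/
theorem hasPrivateAlgorithm_of_variationLE (hT : 2 ≤ T) {ε δ : ℝ} (hε : 0 < ε) (hδ : 0 < δ)
    {Q : GraphSeq V T → Prop} {Adj : GraphSeq V T → GraphSeq V T → Prop} {f : WGraph V → ι → ℝ}
    {Γ : ℝ} (hΓ : 0 < Γ)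
    (h : ∀ S S' : GraphSeq V T, S.PartiallyDynamic → S'.PartiallyDynamic → Q S → Q S' →
      Adj S S' → ∃ B : ι → ℝ,
        (∀ j, VariationLE (fun t => f (S.graphAt t) j - f (S'.graphAt t) j) (B j)) ∧
        ∑ j, B j ≤ Γ) :
    HasPrivateAlgorithm Q Adj f ε δ (300 * (Γ * baseError T ε δ)) := by
  -- For δ ≥ 1 the claimed error is at most 0, but accuracy is vacuous.
  rcases le_or_gt 1 δ with hδ1 | hδ1
  · exact hasPrivateAlgorithm_of_one_le Q Adj f _ hε.le hδ1
  set n := Nat.log 2 T + 1 with hn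
  have hn0 : 0 < n := by omega
  have hn' : (0 : ℝ) < n := by exact_mod_cast hn0
  have hTn : T < 2 ^ n := Nat.lt_pow_succ_log_self (by norm_num) T
  set b : ℝ := n * Γ / ε with hb
  have hb0 : 0 < b := by positivity
  set M : ℝ := 6 * (b * √(2 * n)) with hM
  have hM0 : 0 < M := by positivity
  have hprob := isProbabilityMeasure_cond_Icc hM0
  have hprob' : IsProbabilityMeasure (treeNoise n T M ι) := by
    unfold treeNoise
    infer_instance
  -- The tree mechanism needs a sequence that starts at 0; the jump to the first true value is
  -- counted by `VariationLE`.
  let F : GraphSeq V T → ℕ → ι → ℝ := fun S t j =>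
    match t with
    | 0 => 0
    | t + 1 => f (S.graphAt t) j
  refine ⟨fun S => ⟨(treeNoise n T M ι).map (treeOutput n T b (F S)),
    Measure.isProbabilityMeasure_map (measurable_treeOutput _).aemeasurable⟩, ?_, ?_, ?_⟩
  · intro S S' _ _ t hSS'
    simp only [ProbabilityMeasure.coe_mk]
    rw [Measure.map_map (by fun_prop) (measurable_treeOutput _),
      Measure.map_map (by fun_prop) (measurable_treeOutput _)]
    congr 1
    funext w i j
    simp only [Function.comp, treeOutput, F, GraphSeq.graphAt_eq, hSS' i i.2]
  · intro S S' hS hS' hadj E hE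
    obtain ⟨B, hB, hBΓ⟩ := h S S' hS.1 hS'.1 hS.2 hS'.2 hadj
    refine map_treeOutput_le hM0 hb0 hTn (fun _ => rfl) (fun _ => rfl) hB ?_ hE
    rw [hb, div_mul_cancel₀ _ hε.ne']
    gcongr
  · intro S _ t j
    simp only [ProbabilityMeasure.coe_mk]
    have hset : MeasurableSet {o : Fin T → ι → ℝ |
        |o t j - f (S.graph t.succ) j| ≤ 300 * (Γ * baseError T ε δ)} :=
      measurableSet_le (by fun_prop) (by fun_prop)
    rw [Measure.map_apply (measurable_treeOutput _) hset]
    set σ := b * √(2 * n) with hσ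
    have hσ0 : 0 < σ := by positivity
    set Λ := Real.log (1 / δ) with hΛ
    have hΛδ : 1 - δ ≤ Λ := by
      rw [hΛ, one_div, Real.log_inv]
      linarith [Real.log_le_sub_one_of_pos hδ]
    have hσle : σ * Λ ≤ 8 * (Γ * baseError T ε δ) := by
      have h1 := mul_sqrt_le_rpow hn'.le (natLog_add_one_le hT)
      have h2 : 0 ≤ Γ * (Λ / ε) := mul_nonneg hΓ.le (div_nonneg (by linarith) hε.le)
      calc σ * Λ = n * √(2 * n) * (Γ * (Λ / ε)) := by
            rw [hσ, hb]
            ring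
        _ ≤ 8 * Real.log T ^ (3 / 2 : ℝ) * (Γ * (Λ / ε)) := by gcongr
        _ = 8 * (Γ * baseError T ε δ) := by
            rw [baseError]
            ring
    -- By `hσle` and 37 · 8 ≤ 300, noise of size 37σΛ is within the claimed error.
    have hout : ∀ (r : ℝ), r ≤ 37 * (σ * Λ) →
        {w : (DyadicIndex n T ι → ℝ) × ℝ | |b * ∑ l, w.1 (dyadicPath n T t j l) + w.2| ≤ r} ⊆
        treeOutput n T b (F S) ⁻¹' {o : Fin T → ι → ℝ |
        |o t j - f (S.graph t.succ) j| ≤ 300 * (Γ * baseError T ε δ)} := by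
      intro r hr w hw
      simp only [Set.mem_preimage, Set.mem_ofPred_eq, treeOutput, F, GraphSeq.graphAt_eq] at hw ⊢
      rw [add_assoc, add_sub_cancel_left]
      have : 0 ≤ σ * Λ := mul_nonneg hσ0.le (by linarith)
      linarith
    -- For δ ≤ 3/4, Λ ≥ 1/4 absorbs the constants: y = Λ + 2 gives failure probability 2e⁻¹δ ≤ δ and
    -- error σ(Λ + 2) + 6σ ≤ 33σΛ. For δ > 3/4, the radius r = 2M(1 - δ) ≤ M/2 gives success
    -- probability 1 - δ, and r = 12σ(1 - δ) ≤ 12σΛ.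
    rcases le_or_gt δ (3 / 4) with hδ2 | hδ2
    · have hl : (1 / 4 : ℝ) ≤ Λ := by linarith
      refine le_trans ?_ ((treeNoise_tail hn0 hb0 hM0 t j (Λ + 2)).trans
        (measure_mono (hout _ ?_)))
      · refine ENNReal.ofReal_le_ofReal ?_
        rw [show 1 - (Λ + 2) = -Λ + -1 by ring, Real.exp_add, hΛ, one_div, Real.log_inv, neg_neg,
          Real.exp_log hδ, Real.exp_neg]
        have h1 := Real.add_one_le_exp 1
        have h2 : (Real.exp 1)⁻¹ ≤ 1 / 2 := by
          rw [inv_le_comm₀ (by positivity) (by norm_num)]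
          linarith
        nlinarith
      · rw [← hσ, hM]
        nlinarith
    · refine le_trans ?_ ((treeNoise_concentration hn0 hb0 t j hM (r := 2 * M * (1 - δ))
        (mul_nonneg (by linarith) (by linarith)) (by nlinarith)).trans (measure_mono (hout _ ?_)))
      · rw [mul_div_cancel_left₀ _ (by linarith)]
      · rw [hM]
        nlinarith

end Existence

/-! ### Partially dynamic families of graphs -/

namespace WGraph

variable {V : Type u} [DecidableEq V]

/-- Remove the edges in `X`. -/
def eraseEdges (G : WGraph V) (X : Finset (Sym2 V)) : WGraph V where
  verts := G.verts
  edges := G.edges \ X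
  weight := fun e => if e ∈ X then 0 else G.weight e

/-- Remove the node `x` and its edges. -/
def eraseVert (G : WGraph V) (x : V) : WGraph V where
  verts := G.verts.erase x
  edges := {e ∈ G.edges | x ∉ e}
  weight := fun e => if x ∈ e then 0 else G.weight e

theorem eraseEdges_empty (G : WGraph V) : G.eraseEdges ∅ = G := by
  simp [eraseEdges]

theorem eraseEdges_insert (G : WGraph V) (e : Sym2 V) (X : Finset (Sym2 V)) :
    G.eraseEdges (insert e X) = (G.eraseEdges X).eraseEdges {e} := by
  ext1
  · rfl
  · ext e'
    simp only [eraseEdges, Finset.mem_sdiff, Finset.mem_insert, Finset.mem_singleton]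
    tauto
  · funext e'
    simp only [eraseEdges, Finset.mem_insert, Finset.mem_singleton]
    split_ifs <;> tauto

theorem eraseVert_eraseEdges (G : WGraph V) (x : V) {X : Finset (Sym2 V)}
    (hX : ∀ e ∈ X, x ∈ e) : (G.eraseEdges X).eraseVert x = G.eraseVert x := by
  ext1
  · rfl
  · ext e
    simp only [eraseEdges, eraseVert, Finset.mem_sdiff, Finset.mem_filter]
    have := hX e
    tauto
  · funext e
    have := hX e
    simp only [eraseEdges, eraseVert]
    split_ifs <;> tauto

/-- All degrees are at most `D`. -/
def MaxDegreeLE (D : ℕ) (G : WGraph V) : Prop := ∀ v ∈ G.verts, G.degree v ≤ D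

/-- All weights are at most `W`. -/
def MaxWeightLE (W : ℕ) (G : WGraph V) : Prop := ∀ e ∈ G.edges, G.weight e ≤ W

/-- A property that passes to the graph without some edges. -/
def HereditaryEdges (Q : WGraph V → Prop) : Prop := ∀ G X, Q G → Q (G.eraseEdges X)

theorem hereditaryEdges_maxDegreeLE (D : ℕ) :
    HereditaryEdges (MaxDegreeLE D : WGraph V → Prop) := fun _ _ h v hv =>
  (Finset.card_le_card (Finset.filter_subset_filter _ Finset.sdiff_subset)).trans (h v hv)

theorem hereditaryEdges_maxWeightLE (W : ℕ) :
    HereditaryEdges (MaxWeightLE W : WGraph V → Prop) := fun G X h e he => by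
  have he' := Finset.mem_sdiff.1 he
  simp only [eraseEdges, if_neg he'.2]
  exact h e he'.1

/-- The graphs `G t` are increasing or decreasing subgraphs of one of them. -/
structure IsDynamicFamily (G : ℕ → WGraph V) : Prop where
  monotone_or_antitone :
    (Monotone (fun t => (G t).verts) ∧ Monotone (fun t => (G t).edges)) ∨
    (Antitone (fun t => (G t).verts) ∧ Antitone (fun t => (G t).edges))
  exists_top : ∃ s, ∀ t, (G t).edges ⊆ (G s).edges
  not_isDiag : ∀ t, ∀ e ∈ (G t).edges, ¬ e.IsDiag
  mem_verts : ∀ t, ∀ e ∈ (G t).edges, ∀ v ∈ e, v ∈ (G t).verts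
  exists_weight : ∃ w : Sym2 V → ℕ, ∀ t, ∀ e ∈ (G t).edges, (G t).weight e = w e

theorem IsDynamicFamily.eraseEdges {G : ℕ → WGraph V} (hG : IsDynamicFamily G)
    (X : Finset (Sym2 V)) : IsDynamicFamily fun t => (G t).eraseEdges X where
  monotone_or_antitone := hG.monotone_or_antitone.imp
    (fun h => ⟨h.1, fun _ _ hst => Finset.sdiff_subset_sdiff (h.2 hst) le_rfl⟩)
    (fun h => ⟨h.1, fun _ _ hst => Finset.sdiff_subset_sdiff (h.2 hst) le_rfl⟩)
  exists_top := hG.exists_top.imp fun _ h t => Finset.sdiff_subset_sdiff (h t) le_rfl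
  not_isDiag t e he := hG.not_isDiag t e (Finset.mem_sdiff.1 he).1
  mem_verts t e he := hG.mem_verts t e (Finset.mem_sdiff.1 he).1
  exists_weight := hG.exists_weight.imp fun w h t e he => by
    have he' := Finset.mem_sdiff.1 he
    simp only [WGraph.eraseEdges, if_neg he'.2]
    exact h t e he'.1

/-- Along every dynamic family with the property `Q`, the effect of a single edge on `f` has
variation at most `B`. -/
def EdgeVariationLE (Q : WGraph V → Prop) (f : WGraph V → ℝ) (B : ℝ) : Prop :=
  ∀ G : ℕ → WGraph V, IsDynamicFamily G → (∀ t, Q (G t)) → ∀ e,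
    VariationLE (fun t => f (G t) - f ((G t).eraseEdges {e})) B

/-- Along every dynamic family with the property `Q`, the effect of a single isolated node on `f`
has variation at most `B`. -/
def IsolatedVariationLE (Q : WGraph V → Prop) (f : WGraph V → ℝ) (B : ℝ) : Prop :=
  ∀ G : ℕ → WGraph V, IsDynamicFamily G → (∀ t, Q (G t)) → ∀ x, (∀ t, (G t).incident x = ∅) →
    VariationLE (fun t => f (G t) - f ((G t).eraseVert x)) B

/-- Along every dynamic family with the property `Q`, the effect of a single node on `f` has
variation at most `B`. -/
def NodeVariationLE (Q : WGraph V → Prop) (f : WGraph V → ℝ) (B : ℝ) : Prop :=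
  ∀ G : ℕ → WGraph V, IsDynamicFamily G → (∀ t, Q (G t)) → ∀ x,
    VariationLE (fun t => f (G t) - f ((G t).eraseVert x)) B

variable {Q : WGraph V → Prop} {f : WGraph V → ℝ} {A B : ℝ}

theorem EdgeVariationLE.eraseEdges (hf : EdgeVariationLE Q f B) (hQ : HereditaryEdges Q)
    {G : ℕ → WGraph V} (hG : IsDynamicFamily G) (hQG : ∀ t, Q (G t)) (X : Finset (Sym2 V)) :
    VariationLE (fun t => f (G t) - f ((G t).eraseEdges X)) (X.card * B) := by
  induction X using Finset.induction_on with
  | empty => simpa [eraseEdges_empty] using VariationLE.zero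
  | insert e X he ih =>
    have h := ih.add (hf _ (hG.eraseEdges X) (fun t => hQ _ X (hQG t)) e)
    simp only [sub_add_sub_cancel, ← eraseEdges_insert] at h
    refine h.mono ?_
    rw [Finset.card_insert_of_notMem he]
    push_cast
    linarith

/-- The set of erased edges must not depend on t. The edges at x in the largest graph of the family
are at most D in number, and erasing them isolates x at all times. -/
theorem EdgeVariationLE.nodeVariationLE (hf : EdgeVariationLE Q f B)
    (hf' : IsolatedVariationLE Q f A) (hQ : HereditaryEdges Q) {D : ℕ}
    (hD : ∀ G, Q G → G.MaxDegreeLE D) (hB : 0 ≤ B) : NodeVariationLE Q f (D * B + A) := by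
  intro G hG hQG x
  obtain ⟨s, hs⟩ := hG.exists_top
  set X := (G s).incident x with hX
  have hXx : ∀ e ∈ X, x ∈ e := fun e he => (Finset.mem_filter.1 he).2
  have hcard : X.card ≤ D := by
    -- The degree bound only concerns nodes that are present, which x is as soon as it has an edge.
    rcases X.eq_empty_or_nonempty with h | ⟨e, he⟩
    · simp [h]
    · have he' := Finset.mem_filter.1 he
      exact hD _ (hQG s) x (hG.mem_verts s e he'.1 x he'.2)
  have hiso : ∀ t, ((G t).eraseEdges X).incident x = ∅ := by
    intro t
    refine Finset.eq_empty_of_forall_notMem fun e he => ?_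
    have he' := Finset.mem_filter.1 he
    have he'' := Finset.mem_sdiff.1 he'.1
    exact he''.2 (Finset.mem_filter.2 ⟨hs t he''.1, he'.2⟩)
  have h := (hf.eraseEdges hQ hG hQG X).add
    (hf' _ (hG.eraseEdges X) (fun t => hQ _ X (hQG t)) x hiso)
  simp only [sub_add_sub_cancel, eraseVert_eraseEdges _ x hXx] at h
  refine h.mono ?_
  gcongr

end WGraph

namespace GraphSeq

variable {V : Type u} [DecidableEq V] {T : ℕ}

theorem edge_valid (S : GraphSeq V T) (i : Fin (T + 1)) :
    ∀ e ∈ S.edges i, ¬ e.IsDiag ∧ ∀ v ∈ e, v ∈ S.verts i := by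
  induction i using Fin.induction with
  | zero => exact S.edges_zero
  | succ i ih =>
    intro e he
    rw [S.edges_succ, Finset.mem_union, Finset.mem_sdiff] at he
    rcases he with ⟨he, hd⟩ | he
    · refine ⟨(ih e he).1, fun v hv => ?_⟩
      rw [S.verts_succ]
      refine Finset.mem_union_left _ (Finset.mem_sdiff.2 ⟨(ih e he).2 v hv, fun hvd => hd ?_⟩)
      exact S.eDel_of_vDel i v hvd e he hv
    · exact S.eIns_valid i e he

theorem Incremental.monotone {S : GraphSeq V T} (hS : S.Incremental) :
    Monotone S.verts ∧ Monotone S.edges := by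
  constructor <;> refine Fin.monotone_iff_le_succ.2 fun i => ?_
  · rw [S.verts_succ, (hS i).2, Finset.sdiff_empty]
    exact Finset.subset_union_left
  · rw [S.edges_succ, (hS i).1, Finset.sdiff_empty]
    exact Finset.subset_union_left

theorem Decremental.antitone {S : GraphSeq V T} (hS : S.Decremental) :
    Antitone S.verts ∧ Antitone S.edges := by
  constructor <;> refine Fin.antitone_iff_succ_le.2 fun i => ?_
  · rw [S.verts_succ, (hS i).2, Finset.union_empty]
    exact Finset.sdiff_subset
  · rw [S.edges_succ, (hS i).1, Finset.union_empty]
    exact Finset.sdiff_subset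

theorem PartiallyDynamic.isDynamicFamily {S : GraphSeq V T} (hS : S.PartiallyDynamic) :
    WGraph.IsDynamicFamily S.graphAt where
  monotone_or_antitone := by
    have hm : Monotone fun t : ℕ => (⟨min (t + 1) T, by omega⟩ : Fin (T + 1)) :=
      fun s t hst => Fin.mk_le_mk.2 (by omega)
    exact hS.imp (fun h => ⟨h.monotone.1.comp hm, h.monotone.2.comp hm⟩)
      (fun h => ⟨h.antitone.1.comp_monotone hm, h.antitone.2.comp_monotone hm⟩)
  exists_top := by
    rcases hS with h | h
    · exact ⟨T, fun t => h.monotone.2 (Fin.mk_le_mk.2 (by omega))⟩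
    · exact ⟨0, fun t => h.antitone.2 (Fin.mk_le_mk.2 (by omega))⟩
  not_isDiag t e he := (S.edge_valid _ e he).1
  mem_verts t e he := (S.edge_valid _ e he).2
  exists_weight := ⟨S.weight, fun t e he => if_pos he⟩

/-- Degree and weight bounds are only given for the indices 1, …, T; the clamping in `graphAt` never
reaches index 0. -/
theorem graphAt_of_forall_succ {S : GraphSeq V T} (hT : 0 < T) {Q : WGraph V → Prop}
    (h : ∀ i : Fin T, Q (S.graph i.succ)) (t : ℕ) : Q (S.graphAt t) := by
  have : (⟨min (t + 1) T, by omega⟩ : Fin (T + 1)) = (⟨min t (T - 1), by omega⟩ : Fin T).succ :=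
    Fin.ext (by simp; omega)
  rw [graphAt, this]
  exact h _

theorem DropsOnce.mem_iff {α : Type u} [DecidableEq α] {x : α} {A A' : Fin T → Finset α}
    (h : DropsOnce x A A') (t : Fin T) {y : α} (hy : y ≠ x) : y ∈ A t ↔ y ∈ A' t := by
  obtain ⟨hsub, s, hs, hne⟩ := h
  refine ⟨fun hyA => ?_, fun hyA => hsub t hyA⟩
  by_contra hyA'
  rcases eq_or_ne t s with rfl | hts
  · have : y ∈ A t \ A' t := Finset.mem_sdiff.2 ⟨hyA, hyA'⟩
    rw [hs, Finset.mem_singleton] at this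
    exact hy this
  · exact hyA' (hne t hts ▸ hyA)

/-- By induction on the updates, everything apart from `x` agrees. Erasing also resets the weight of
`x`, which may differ between the two sequences. -/
theorem EdgeAdjOn.eraseEdges_eq {x : Sym2 V} {S S' : GraphSeq V T} (h : EdgeAdjOn x S S')
    (i : Fin (T + 1)) : (S.graph i).eraseEdges {x} = (S'.graph i).eraseEdges {x} := by
  obtain ⟨h0, hw, hvd, hvi, hadj⟩ := h
  have hd : ∀ t e, e ≠ x → (e ∈ S.eDel t ↔ e ∈ S'.eDel t) := fun t e he => by
    rcases hadj with ⟨h1, -⟩ | ⟨-, h2⟩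
    · rw [h1]
    · exact h2.mem_iff t he
  have hi : ∀ t e, e ≠ x → (e ∈ S.eIns t ↔ e ∈ S'.eIns t) := fun t e he => by
    rcases hadj with ⟨-, h2⟩ | ⟨h1, -⟩
    · exact h2.mem_iff t he
    · rw [h1]
  have key : S.verts i = S'.verts i ∧ ∀ e, e ≠ x → (e ∈ S.edges i ↔ e ∈ S'.edges i) := by
    induction i using Fin.induction with
    | zero =>
      exact ⟨congrArg WGraph.verts h0, fun e _ => by
        rw [show S.edges 0 = S'.edges 0 from congrArg WGraph.edges h0]⟩
    | succ i ih =>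
      refine ⟨by rw [S.verts_succ, S'.verts_succ, ih.1, hvd, hvi], fun e he => ?_⟩
      rw [S.edges_succ, S'.edges_succ, Finset.mem_union, Finset.mem_sdiff, Finset.mem_union,
        Finset.mem_sdiff, ih.2 e he, hd i e he, hi i e he]
  ext1
  · exact key.1
  · ext e
    simp only [WGraph.eraseEdges, graph, Finset.mem_sdiff, Finset.mem_singleton]
    have := key.2 e
    tauto
  · funext e
    simp only [WGraph.eraseEdges, graph, Finset.mem_singleton]
    by_cases he : e = x
    · rw [if_pos he, if_pos he]
    · simp only [key.2 e he, hw e he]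

theorem NodeAdjOn.eraseVert_eq {x : V} {S S' : GraphSeq V T} (h : NodeAdjOn x S S')
    (i : Fin (T + 1)) : (S.graph i).eraseVert x = (S'.graph i).eraseVert x := by
  obtain ⟨h0, hw, hadj, -, -, hi, hd⟩ := h
  have hvd : ∀ t v, v ≠ x → (v ∈ S.vDel t ↔ v ∈ S'.vDel t) := fun t e he => by
    rcases hadj with ⟨h1, -⟩ | ⟨-, h2⟩
    · rw [h1]
    · exact h2.mem_iff t he
  have hvi : ∀ t v, v ≠ x → (v ∈ S.vIns t ↔ v ∈ S'.vIns t) := fun t e he => by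
    rcases hadj with ⟨-, h2⟩ | ⟨h1, -⟩
    · exact h2.mem_iff t he
    · rw [h1]
  have key : (∀ v, v ≠ x → (v ∈ S.verts i ↔ v ∈ S'.verts i)) ∧
      ∀ e, x ∉ e → (e ∈ S.edges i ↔ e ∈ S'.edges i) := by
    induction i using Fin.induction with
    | zero =>
      refine ⟨fun v _ => ?_, fun e _ => ?_⟩
      · rw [show S.verts 0 = S'.verts 0 from congrArg WGraph.verts h0]
      · rw [show S.edges 0 = S'.edges 0 from congrArg WGraph.edges h0]
    | succ i ih =>
      refine ⟨fun v hv => ?_, fun e he => ?_⟩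
      · rw [S.verts_succ, S'.verts_succ, Finset.mem_union, Finset.mem_sdiff, Finset.mem_union,
          Finset.mem_sdiff, ih.1 v hv, hvd i v hv, hvi i v hv]
      · rw [S.edges_succ, S'.edges_succ, Finset.mem_union, Finset.mem_sdiff, Finset.mem_union,
          Finset.mem_sdiff, ih.2 e he, hd i e he, hi i e he]
  ext1
  · ext v
    simp only [WGraph.eraseVert, graph, Finset.mem_erase]
    have := key.1 v
    tauto
  · ext e
    simp only [WGraph.eraseVert, graph, Finset.mem_filter]
    have := key.2 e
    tauto
  · funext e
    simp only [WGraph.eraseVert, graph]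
    by_cases he : x ∈ e
    · rw [if_pos he, if_pos he]
    · simp only [key.2 e he, hw e he]

/-- Compare both sequences with their common erased sequence; each of the two effects contributes
`B`. -/
theorem EdgeAdj.variationLE {S S' : GraphSeq V T} (h : EdgeAdj S S')
    (hS : S.PartiallyDynamic) (hS' : S'.PartiallyDynamic) {Q : WGraph V → Prop}
    (hQ : ∀ t, Q (S.graphAt t)) (hQ' : ∀ t, Q (S'.graphAt t)) {f : WGraph V → ℝ} {B : ℝ}
    (hf : WGraph.EdgeVariationLE Q f B) :
    VariationLE (fun t => f (S.graphAt t) - f (S'.graphAt t)) (B + B) := by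
  obtain ⟨x, hx⟩ := h
  have heq : ∀ t, (S.graphAt t).eraseEdges {x} = (S'.graphAt t).eraseEdges {x} := fun t =>
    hx.elim (fun h => h.eraseEdges_eq _) (fun h => (h.eraseEdges_eq _).symm)
  have := (hf _ hS.isDynamicFamily hQ x).sub (hf _ hS'.isDynamicFamily hQ' x)
  simpa only [heq, sub_sub_sub_cancel_right] using this

theorem NodeAdj.variationLE {S S' : GraphSeq V T} (h : NodeAdj S S')
    (hS : S.PartiallyDynamic) (hS' : S'.PartiallyDynamic) {Q : WGraph V → Prop}
    (hQ : ∀ t, Q (S.graphAt t)) (hQ' : ∀ t, Q (S'.graphAt t)) {f : WGraph V → ℝ} {B : ℝ}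
    (hf : WGraph.NodeVariationLE Q f B) :
    VariationLE (fun t => f (S.graphAt t) - f (S'.graphAt t)) (B + B) := by
  obtain ⟨x, hx⟩ := h
  have heq : ∀ t, (S.graphAt t).eraseVert x = (S'.graphAt t).eraseVert x := fun t =>
    hx.elim (fun h => h.eraseVert_eq _) (fun h => (h.eraseVert_eq _).symm)
  have := (hf _ hS.isDynamicFamily hQ x).sub (hf _ hS'.isDynamicFamily hQ' x)
  simpa only [heq, sub_sub_sub_cancel_right] using this

end GraphSeq

/-! ### Variation bounds for counting functions -/

namespace WGraph

variable {V : Type u}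

theorem IsDynamicFamily.comp {G : ℕ → WGraph V} (hG : IsDynamicFamily G) {α : Type*} [Preorder α]
    {φ : WGraph V → α}
    (hφ : ∀ G H : WGraph V, G.verts ⊆ H.verts → G.edges ⊆ H.edges → φ G ≤ φ H) :
    Monotone (fun t => φ (G t)) ∨ Antitone (fun t => φ (G t)) :=
  hG.monotone_or_antitone.imp (fun h _ _ hst => hφ _ _ (h.1 hst) (h.2 hst))
    (fun h _ _ hst => hφ _ _ (h.1 hst) (h.2 hst))

variable [DecidableEq V] {Q : WGraph V → Prop}

theorem degree_mono {G H : WGraph V} (h : G.edges ⊆ H.edges) (v : V) : G.degree v ≤ H.degree v :=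
  Finset.card_le_card (Finset.filter_subset_filter _ h)

theorem eraseEdges_edges_subset {G H : WGraph V} (h : G.edges ⊆ H.edges) (X : Finset (Sym2 V)) :
    (G.eraseEdges X).edges ⊆ (H.eraseEdges X).edges :=
  Finset.sdiff_subset_sdiff h le_rfl

theorem eraseVert_edges {G : WGraph V} {x : V} (h : G.incident x = ∅) :
    (G.eraseVert x).edges = G.edges :=
  Finset.filter_true_of_mem fun e he hx => by
    have : e ∈ G.incident x := Finset.mem_filter.2 ⟨he, hx⟩
    simp [h] at this

theorem degree_eraseEdges_of_notMem (G : WGraph V) {e : Sym2 V} {v : V} (h : v ∉ e) :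
    (G.eraseEdges {e}).degree v = G.degree v := by
  refine congrArg Finset.card (Finset.ext fun e' => ?_)
  simp only [incident, eraseEdges, Finset.mem_filter, Finset.mem_sdiff, Finset.mem_singleton]
  constructor
  · tauto
  · rintro ⟨h1, h2⟩
    exact ⟨⟨h1, fun h3 => h (h3 ▸ h2)⟩, h2⟩

theorem degree_eraseEdges_of_mem (G : WGraph V) {e : Sym2 V} {v : V} (h : v ∈ e)
    (he : e ∈ G.edges) : (G.eraseEdges {e}).degree v + 1 = G.degree v := by
  have h1 : e ∈ G.incident v := Finset.mem_filter.2 ⟨he, h⟩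
  have h2 : (G.eraseEdges {e}).incident v = (G.incident v).erase e := by
    ext e'
    simp only [incident, eraseEdges, Finset.mem_filter, Finset.mem_sdiff, Finset.mem_singleton,
      Finset.mem_erase]
    tauto
  rw [degree, h2, Finset.card_erase_add_one h1, degree]

theorem eraseEdges_singleton_edges_of_notMem (G : WGraph V) {e : Sym2 V} (he : e ∉ G.edges) :
    (G.eraseEdges {e}).edges = G.edges :=
  Finset.sdiff_eq_self_of_disjoint (Finset.disjoint_singleton_right.2 he)

theorem edgeVariationLE_edgeCount :
    EdgeVariationLE Q (fun G : WGraph V => (G.edgeCount : ℝ)) 2 := by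
  intro G hG _ e
  convert! VariationLE.indicator (hG.comp (φ := fun G => e ∈ G.edges) fun _ _ _ h he => h he)
    using 2 with t
  split_ifs with he
  · have : ((G t).eraseEdges {e}).edges = (G t).edges.erase e := Finset.sdiff_singleton_eq_erase _ _
    simp only [edgeCount, this, ← Finset.card_erase_add_one he]
    push_cast
    ring
  · simp only [edgeCount, eraseEdges_singleton_edges_of_notMem _ he, sub_self]

theorem isolatedVariationLE_edgeCount :
    IsolatedVariationLE Q (fun G : WGraph V => (G.edgeCount : ℝ)) 0 := by
  intro G _ _ x hx
  simpa [edgeCount, eraseVert_edges (hx _)] using VariationLE.zero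

/-- The sum of `φ (deg v)` over all nodes `v`. -/
def degreeSum (φ : ℕ → ℝ) (G : WGraph V) : ℝ := ∑ v ∈ G.verts, φ (G.degree v)

/-- Only the endpoints of `e` change their degree. -/
theorem degreeSum_sub_eraseEdges (φ : ℕ → ℝ) (G : WGraph V) (e : Sym2 V) :
    G.degreeSum φ - (G.eraseEdges {e}).degreeSum φ = ∑ v ∈ e.toFinset,
      if v ∈ G.verts then φ (G.degree v) - φ ((G.eraseEdges {e}).degree v) else 0 := by
  have h1 : (G.eraseEdges {e}).verts = G.verts := rfl
  rw [degreeSum, degreeSum, h1, ← Finset.sum_sub_distrib, Finset.sum_ite_mem, Finset.inter_comm]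
  refine (Finset.sum_subset Finset.inter_subset_left fun v hv hv' => ?_).symm
  have : v ∉ e := fun h => hv' (Finset.mem_inter.2 ⟨hv, Sym2.mem_toFinset.2 h⟩)
  rw [degree_eraseEdges_of_notMem G this, sub_self]

theorem sum_toFinset_const_le (e : Sym2 V) {B : ℝ} (hB : 0 ≤ B) :
    ∑ _v ∈ e.toFinset, B ≤ 2 * B := by
  rw [Finset.sum_const, nsmul_eq_mul]
  have : e.toFinset.card ≤ 2 := by
    rw [Sym2.card_toFinset]
    split_ifs <;> simp
  gcongr
  exact_mod_cast this

theorem isolatedVariationLE_degreeSum {φ : ℕ → ℝ} (h0 : 0 ≤ φ 0) (h1 : φ 0 ≤ 1) :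
    IsolatedVariationLE Q (degreeSum φ : WGraph V → ℝ) 2 := by
  intro G hG _ x hx
  have key : ∀ t, (G t).degreeSum φ - ((G t).eraseVert x).degreeSum φ =
      if x ∈ (G t).verts then φ 0 else 0 := by
    intro t
    have hd : ∀ v, ((G t).eraseVert x).degree v = (G t).degree v := fun v => by
      rw [degree, degree, incident, incident, eraseVert_edges (hx t)]
    have hv : ((G t).eraseVert x).verts = (G t).verts.erase x := rfl
    simp only [degreeSum, hd, hv]
    split_ifs with h
    · rw [← Finset.add_sum_erase _ _ h, add_sub_cancel_right, degree, hx t, Finset.card_empty]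
    · rw [Finset.erase_eq_of_notMem h, sub_self]
  simp only [key]
  rw [← mul_one (2 : ℝ)]
  refine VariationLE.of_monotone_or_antitone
    (hG.comp (φ := fun G => if x ∈ G.verts then φ 0 else 0) fun G H h _ => ?_)
    (fun t => by split_ifs <;> simp [h0]) (fun t => by split_ifs <;> simp [h1])
  split_ifs with h2 h3
  · exact le_rfl
  · exact absurd (h h2) h3
  · exact h0
  · exact le_rfl

theorem highDegreeCount_eq_degreeSum (τ : ℕ) (G : WGraph V) :
    (G.highDegreeCount τ : ℝ) = G.degreeSum fun d => if τ ≤ d then 1 else 0 := by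
  simp [highDegreeCount, degreeSum, Finset.sum_boole]

/-- At each endpoint the effect is a difference of two monotone indicators, with and without `e`, of
variation 2 + 2; there are at most two endpoints. -/
theorem edgeVariationLE_highDegreeCount (τ : ℕ) :
    EdgeVariationLE Q (fun G : WGraph V => (G.highDegreeCount τ : ℝ)) 8 := by
  intro G hG _ e
  simp only [highDegreeCount_eq_degreeSum, degreeSum_sub_eraseEdges]
  refine (VariationLE.sum e.toFinset (C := fun _ => 2 + 2) fun v _ => ?_).mono
    ((sum_toFinset_const_le e (by norm_num)).trans (by norm_num))
  convert! (VariationLE.indicator (hG.comp (φ := fun G => v ∈ G.verts ∧ τ ≤ G.degree v)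
      fun G H hv he h => ⟨hv h.1, h.2.trans (degree_mono he v)⟩)).sub
    (VariationLE.indicator (hG.comp
      (φ := fun G => v ∈ G.verts ∧ τ ≤ (G.eraseEdges {e}).degree v)
      fun G H hv he h => ⟨hv h.1, h.2.trans (degree_mono (eraseEdges_edges_subset he _) v)⟩))
    using 2 with t
  by_cases hv : v ∈ (G t).verts <;> simp [hv]

theorem isolatedVariationLE_highDegreeCount (τ : ℕ) :
    IsolatedVariationLE Q (fun G : WGraph V => (G.highDegreeCount τ : ℝ)) 2 := by
  simp only [highDegreeCount_eq_degreeSum]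
  exact isolatedVariationLE_degreeSum (by split_ifs <;> simp) (by split_ifs <;> simp)

/-- Having degree exactly j is not a monotone condition along the family, but the two threshold
conditions are. -/
theorem degreeBin_eq_sub (j : ℕ) (G : WGraph V) :
    (G.degreeBin j : ℝ) = G.highDegreeCount j - G.highDegreeCount (j + 1) := by
  rw [highDegreeCount_eq_degreeSum, highDegreeCount_eq_degreeSum, degreeSum, degreeSum,
    ← Finset.sum_sub_distrib, degreeBin, Finset.card_filter]
  push_cast
  refine Finset.sum_congr rfl fun v _ => ?_
  split_ifs <;> first | omega | simp

theorem kStarCount_eq_degreeSum (k : ℕ) (G : WGraph V) :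
    (G.kStarCount k : ℝ) = G.degreeSum fun d => (d.choose k : ℝ) := by
  simp [kStarCount, degreeSum, degree]

theorem edgeVariationLE_kStarCount_zero :
    EdgeVariationLE Q (fun G : WGraph V => (G.kStarCount 0 : ℝ)) 0 := by
  intro G _ _ e
  simpa [kStarCount_eq_degreeSum, degreeSum_sub_eraseEdges] using VariationLE.zero

/-- By Pascal's rule, `e` lies in C(d, k) of the (k + 1)-stars centred at an endpoint of degree d
without `e`. This number is monotone along the family and at most D ^ k. -/
theorem edgeVariationLE_kStarCount_succ (D k : ℕ) :
    EdgeVariationLE (MaxDegreeLE D) (fun G : WGraph V => (G.kStarCount (k + 1) : ℝ))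
      (4 * D ^ k) := by
  intro G hG hD e
  simp only [kStarCount_eq_degreeSum, degreeSum_sub_eraseEdges]
  refine (VariationLE.sum e.toFinset (C := fun _ => 2 * D ^ k) fun v hv => ?_).mono
    ((sum_toFinset_const_le e (by positivity)).trans (by linarith))
  rw [Sym2.mem_toFinset] at hv
  have key : ∀ t, (if v ∈ (G t).verts then (((G t).degree v).choose (k + 1) : ℝ) -
      (((G t).eraseEdges {e}).degree v).choose (k + 1) else 0) =
      if v ∈ (G t).verts ∧ e ∈ (G t).edges then
        ((((G t).eraseEdges {e}).degree v).choose k : ℝ) else 0 := by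
    intro t
    by_cases he : e ∈ (G t).edges
    · by_cases h : v ∈ (G t).verts
      · simp only [h, he, and_self, if_true]
        rw [← degree_eraseEdges_of_mem _ hv he, Nat.choose_succ_succ]
        push_cast
        ring
      · simp [h]
    · have : ((G t).eraseEdges {e}).degree v = (G t).degree v := by
        rw [degree, degree, incident, incident, eraseEdges_singleton_edges_of_notMem _ he]
      simp [he, this]
  simp only [key]
  refine VariationLE.of_monotone_or_antitone (hG.comp (φ := fun G =>
    if v ∈ G.verts ∧ e ∈ G.edges then (((G.eraseEdges {e}).degree v).choose k : ℝ) else 0)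
    fun G H h1 h2 => ?_) (fun t => by positivity) (fun t => ?_)
  · split_ifs with h3 h4
    · exact_mod_cast Nat.choose_le_choose k (degree_mono (eraseEdges_edges_subset h2 _) v)
    · exact absurd ⟨h1 h3.1, h2 h3.2⟩ h4
    · positivity
    · exact le_rfl
  · split_ifs with h
    · have h1 : ((G t).eraseEdges {e}).degree v ≤ D :=
        hereditaryEdges_maxDegreeLE D _ _ (hD t) v h.1
      exact_mod_cast (Nat.choose_le_pow _ k).trans (Nat.pow_le_pow_left h1 k)
    · positivity

theorem isolatedVariationLE_kStarCount (k : ℕ) :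
    IsolatedVariationLE Q (fun G : WGraph V => (G.kStarCount k : ℝ)) 2 := by
  simp only [kStarCount_eq_degreeSum]
  refine isolatedVariationLE_degreeSum (by positivity) ?_
  cases k <;> simp

/-- The triangles of `G`. -/
def triangles (G : WGraph V) : Finset (Finset V) :=
  {s ∈ G.verts.powersetCard 3 | ∀ a ∈ s, ∀ b ∈ s, a ≠ b → s(a, b) ∈ G.edges}

theorem mem_triangles {G : WGraph V} {s : Finset V} : s ∈ G.triangles ↔
    (s ⊆ G.verts ∧ s.card = 3) ∧ ∀ a ∈ s, ∀ b ∈ s, a ≠ b → s(a, b) ∈ G.edges := by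
  rw [triangles, Finset.mem_filter, Finset.mem_powersetCard]

theorem triangles_mono {G H : WGraph V} (hv : G.verts ⊆ H.verts) (he : G.edges ⊆ H.edges) :
    G.triangles ⊆ H.triangles := fun s hs => by
  rw [mem_triangles] at hs ⊢
  exact ⟨⟨hs.1.1.trans hv, hs.1.2⟩, fun a ha b hb hab => he (hs.2 a ha b hb hab)⟩

/-- The triangles of `G` of which `s(u, v)` is an edge. -/
def trianglesAt (G : WGraph V) (u v : V) : Finset (Finset V) :=
  {s ∈ G.triangles | u ∈ s ∧ v ∈ s}

theorem triangleCount_sub_eraseEdges (G : WGraph V) {u v : V} (huv : u ≠ v) :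
    (G.triangleCount : ℝ) - (G.eraseEdges {s(u, v)}).triangleCount = (G.trianglesAt u v).card := by
  have h : (G.eraseEdges {s(u, v)}).triangles = {s ∈ G.triangles | ¬ (u ∈ s ∧ v ∈ s)} := by
    ext s
    rw [Finset.mem_filter, mem_triangles, mem_triangles]
    simp only [eraseEdges, Finset.mem_sdiff, Finset.mem_singleton]
    constructor
    · rintro ⟨h1, h2⟩
      exact ⟨⟨h1, fun a ha b hb hab => (h2 a ha b hb hab).1⟩,
        fun h => (h2 u h.1 v h.2 huv).2 rfl⟩
    · rintro ⟨⟨h1, h2⟩, h3⟩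
      refine ⟨h1, fun a ha b hb hab => ⟨h2 a ha b hb hab, fun h => h3 ?_⟩⟩
      rcases Sym2.eq_iff.1 h with ⟨rfl, rfl⟩ | ⟨rfl, rfl⟩
      · exact ⟨ha, hb⟩
      · exact ⟨hb, ha⟩
  have h1 : (G.eraseEdges {s(u, v)}).triangleCount =
    (G.eraseEdges {s(u, v)}).triangles.card := rfl
  have h2 : G.triangleCount = G.triangles.card := rfl
  rw [h1, h2, h, trianglesAt, ← Finset.card_filter_add_card_filter_not (fun s => u ∈ s ∧ v ∈ s)
    (s := G.triangles)]
  push_cast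
  ring

/-- A triangle through u and v is determined by its edge from u to the third node. -/
theorem card_trianglesAt_le (G : WGraph V) {u v : V} (huv : u ≠ v) :
    (G.trianglesAt u v).card ≤ G.degree u := by
  refine (Finset.card_le_card (t := (G.incident u).image fun e => insert v e.toFinset)
    fun s hs => ?_).trans Finset.card_image_le
  rw [trianglesAt, Finset.mem_filter, mem_triangles] at hs
  obtain ⟨⟨⟨-, h3⟩, h⟩, hu, hv⟩ := hs
  have h1 : ((s.erase u).erase v).card = 1 := by
    rw [Finset.card_erase_of_mem (Finset.mem_erase.2 ⟨huv.symm, hv⟩), Finset.card_erase_of_mem hu,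
      h3]
  obtain ⟨w, hw⟩ := Finset.card_eq_one.1 h1
  have hws : w ∈ (s.erase u).erase v := hw ▸ Finset.mem_singleton_self w
  simp only [Finset.mem_erase] at hws
  refine Finset.mem_image.2 ⟨s(u, w), Finset.mem_filter.2
    ⟨h u hu w hws.2.2 hws.2.1.symm, Sym2.mem_mk_left _ _⟩, ?_⟩
  ext a
  simp only [Finset.mem_insert, Sym2.mem_toFinset, Sym2.mem_iff]
  constructor
  · rintro (rfl | rfl | rfl)
    exacts [hv, hu, hws.2.2]
  · intro ha
    by_contra! hc
    have : a ∈ (s.erase u).erase v := by simp [ha, hc.1, hc.2.1]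
    rw [hw, Finset.mem_singleton] at this
    exact hc.2.2 this

theorem edgeVariationLE_triangleCount (D : ℕ) :
    EdgeVariationLE (MaxDegreeLE D) (fun G : WGraph V => (G.triangleCount : ℝ)) (2 * D) := by
  intro G hG hD e
  induction e using Sym2.ind with
  | _ u v =>
    rcases eq_or_ne u v with rfl | huv
    · have h : ∀ t, (((G t).eraseEdges {s(u, u)}).triangleCount) = (G t).triangleCount := by
        intro t
        have : s(u, u) ∉ (G t).edges := fun h => hG.not_isDiag t _ h (by simp)
        rw [triangleCount, triangleCount, eraseEdges_singleton_edges_of_notMem _ this]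
        rfl
      simp only [h, sub_self]
      exact VariationLE.zero.mono (by positivity)
    · simp only [triangleCount_sub_eraseEdges _ huv]
      refine VariationLE.of_monotone_or_antitone (hG.comp
        (φ := fun G => ((G.trianglesAt u v).card : ℝ)) fun G H hv he => ?_)
        (fun t => by positivity) (fun t => ?_)
      · exact_mod_cast Finset.card_le_card
          (Finset.filter_subset_filter _ (triangles_mono hv he))
      · rcases ((G t).trianglesAt u v).eq_empty_or_nonempty with h | ⟨s, hs⟩
        · simp [h]
        · have hs' := Finset.mem_filter.1 hs
          have hu : u ∈ (G t).verts := (mem_triangles.1 hs'.1).1.1 hs'.2.1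
          exact_mod_cast (card_trianglesAt_le _ huv).trans (hD t u hu)

theorem isolatedVariationLE_triangleCount :
    IsolatedVariationLE Q (fun G : WGraph V => (G.triangleCount : ℝ)) 0 := by
  intro G _ _ x hx
  have h : ∀ t, ((G t).eraseVert x).triangleCount = (G t).triangleCount := by
    intro t
    refine congrArg Finset.card (Finset.ext fun s => ?_)
    change s ∈ triangles _ ↔ s ∈ triangles _
    rw [mem_triangles, mem_triangles, eraseVert_edges (hx t)]
    refine ⟨fun h => ⟨⟨h.1.1.trans (Finset.erase_subset _ _), h.1.2⟩, h.2⟩, 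
      fun h => ⟨⟨?_, h.1.2⟩, h.2⟩⟩
    refine Finset.subset_erase.2 ⟨h.1.1, fun hxs => ?_⟩
    obtain ⟨y, hy, hyx⟩ := Finset.exists_mem_ne (by omega : 1 < s.card) x
    have : s(x, y) ∈ (G t).incident x :=
      Finset.mem_filter.2 ⟨h.2 x hxs y hy hyx.symm, Sym2.mem_mk_left _ _⟩
    simp [hx t] at this
  simpa [h] using VariationLE.zero

end WGraph

/-! ### The graphic rank and minimum spanning forests -/

namespace GraphicRank

variable {V : Type u}

/-- The incidence vector of an edge over the field with two elements. -/
noncomputable def edgeVec : Sym2 V → V →₀ ZMod 2 :=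
  Sym2.lift ⟨fun u v => Finsupp.single u 1 + Finsupp.single v 1, fun _ _ => add_comm _ _⟩

theorem edgeVec_mk (u v : V) : edgeVec s(u, v) = Finsupp.single u 1 + Finsupp.single v 1 := rfl

theorem single_add_self (u : V) :
    Finsupp.single u (1 : ZMod 2) + Finsupp.single u 1 = 0 := by
  rw [← Finsupp.single_add, CharTwo.add_self_eq_zero, Finsupp.single_zero]

/-- The span of the incidence vectors of the edges in `E`. -/
noncomputable def edgeSpan (E : Set (Sym2 V)) : Submodule (ZMod 2) (V →₀ ZMod 2) :=
  Submodule.span (ZMod 2) (edgeVec '' E)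

theorem edgeSpan_mono {E F : Set (Sym2 V)} (h : E ⊆ F) : edgeSpan E ≤ edgeSpan F :=
  Submodule.span_mono (Set.image_mono h)

theorem edgeVec_mem_edgeSpan {E : Set (Sym2 V)} {e : Sym2 V} (h : e ∈ E) :
    edgeVec e ∈ edgeSpan E :=
  Submodule.subset_span (Set.mem_image_of_mem _ h)

/-- Modulo 2 the vectors of the edges of a walk telescope. -/
theorem edgeVec_mem_edgeSpan_of_reachable {E : Set (Sym2 V)} {u v : V}
    (h : (SimpleGraph.fromEdgeSet E).Reachable u v) : edgeVec s(u, v) ∈ edgeSpan E := by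
  obtain ⟨p⟩ := h
  induction p with
  | nil =>
    rw [edgeVec_mk, single_add_self]
    exact Submodule.zero_mem _
  | cons hadj p ih =>
    have h1 := edgeVec_mem_edgeSpan (E := E) ((SimpleGraph.fromEdgeSet_adj _).1 hadj).1
    have h2 := Submodule.add_mem _ h1 ih
    rw [edgeVec_mk, edgeVec_mk] at h2
    rw [edgeVec_mk]
    rwa [add_assoc, ← add_assoc (Finsupp.single _ 1) (Finsupp.single _ 1) (Finsupp.single _ 1),
      single_add_self, zero_add] at h2

/-- Otherwise the functional summing the coordinates over the component of u kills all edge vectors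
of E but is 1 on that of s(u, v). -/
theorem reachable_of_edgeVec_mem_edgeSpan {E : Set (Sym2 V)} {u v : V}
    (h : edgeVec s(u, v) ∈ edgeSpan E) : (SimpleGraph.fromEdgeSet E).Reachable u v := by
  classical
  by_contra hn
  let φ : (V →₀ ZMod 2) →ₗ[ZMod 2] ZMod 2 := Finsupp.linearCombination (ZMod 2)
    fun w => if (SimpleGraph.fromEdgeSet E).Reachable u w then (1 : ZMod 2) else 0
  have hφ : ∀ a b : V, φ (edgeVec s(a, b)) =
      (if (SimpleGraph.fromEdgeSet E).Reachable u a then (1 : ZMod 2) else 0) +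
      (if (SimpleGraph.fromEdgeSet E).Reachable u b then (1 : ZMod 2) else 0) := fun a b => by
    simp [φ, edgeVec_mk, Finsupp.linearCombination_single]
  have hle : edgeSpan E ≤ LinearMap.ker φ := by
    refine Submodule.span_le.2 ?_
    rintro _ ⟨e, he, rfl⟩
    induction e using Sym2.ind with
    | _ a b =>
      rw [SetLike.mem_coe, LinearMap.mem_ker, hφ]
      rcases eq_or_ne a b with rfl | hab
      · exact CharTwo.add_self_eq_zero _
      · have hadj : (SimpleGraph.fromEdgeSet E).Adj a b :=
          (SimpleGraph.fromEdgeSet_adj _).2 ⟨he, hab⟩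
        have : (SimpleGraph.fromEdgeSet E).Reachable u a ↔
            (SimpleGraph.fromEdgeSet E).Reachable u b :=
          ⟨fun h => h.trans hadj.reachable, fun h => h.trans hadj.symm.reachable⟩
        simp only [this]
        exact CharTwo.add_self_eq_zero _
  have h1 := LinearMap.mem_ker.1 (hle h)
  rw [hφ, if_pos (SimpleGraph.Reachable.refl u), if_neg hn] at h1
  simp at h1

/-- Acyclic means that each edge is a bridge: the other edges do not connect its ends, that is, do
not span its vector. Loops are excluded because `fromEdgeSet` ignores them while their vector is 0.
-/
theorem isAcyclic_iff_linearIndepOn {F : Set (Sym2 V)} (hF : ∀ e ∈ F, ¬ e.IsDiag) :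
    (SimpleGraph.fromEdgeSet F).IsAcyclic ↔ LinearIndepOn (ZMod 2) edgeVec F := by
  rw [linearIndepOn_iff_notMem_span, SimpleGraph.isAcyclic_iff_forall_adj_isBridge]
  have key : ∀ a b : V, (SimpleGraph.fromEdgeSet F).IsBridge s(a, b) ↔
      edgeVec s(a, b) ∉ edgeSpan (F \ {s(a, b)}) := by
    intro a b
    rw [SimpleGraph.isBridge_iff]
    have : (SimpleGraph.fromEdgeSet F).deleteEdges {s(a, b)} =
        SimpleGraph.fromEdgeSet (F \ {s(a, b)}) := by
      ext x y
      simp only [SimpleGraph.deleteEdges_adj, SimpleGraph.fromEdgeSet_adj, Set.mem_sdiff]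
      tauto
    rw [this]
    exact not_congr ⟨edgeVec_mem_edgeSpan_of_reachable, reachable_of_edgeVec_mem_edgeSpan⟩
  constructor
  · intro h e he
    induction e using Sym2.ind with
    | _ a b =>
      refine (key a b).1 (h ((SimpleGraph.fromEdgeSet_adj _).2 ⟨he, fun hab => ?_⟩))
      exact hF _ he (Sym2.mk_isDiag_iff.2 hab)
  · intro h a b hab
    exact (key a b).2 (h _ ((SimpleGraph.fromEdgeSet_adj _).1 hab).1)

/-- The rank of a set of edges: the number of edges of a spanning forest. -/
noncomputable def rank (E : Set (Sym2 V)) : ℕ := Module.finrank (ZMod 2) (edgeSpan E)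

theorem finiteDimensional_edgeSpan {E : Set (Sym2 V)} (hE : E.Finite) :
    FiniteDimensional (ZMod 2) (edgeSpan E) :=
  FiniteDimensional.span_of_finite _ (hE.image _)

theorem rank_mono {E F : Set (Sym2 V)} (hF : F.Finite) (h : E ⊆ F) : rank E ≤ rank F :=
  have := finiteDimensional_edgeSpan hF
  Submodule.finrank_mono (edgeSpan_mono h)

theorem rank_eq_card {F : Finset (Sym2 V)}
    (hF : LinearIndepOn (ZMod 2) edgeVec (F : Set (Sym2 V))) :
    rank (F : Set (Sym2 V)) = F.card := by
  have := finrank_span_eq_card hF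
  rw [rank, edgeSpan, Set.image_eq_range]
  simpa using this

theorem edgeSpan_insert (e : Sym2 V) (E : Set (Sym2 V)) :
    edgeSpan (insert e E) = edgeSpan E ⊔ Submodule.span (ZMod 2) {edgeVec e} := by
  rw [edgeSpan, Set.image_insert_eq, Submodule.span_insert, sup_comm, edgeSpan]

theorem edgeSpan_insert_of_mem {e : Sym2 V} {E : Set (Sym2 V)} (h : edgeVec e ∈ edgeSpan E) :
    edgeSpan (insert e E) = edgeSpan E := by
  rw [edgeSpan_insert, sup_eq_left, Submodule.span_singleton_le_iff_mem]
  exact h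

theorem rank_insert_of_notMem {e : Sym2 V} {E : Set (Sym2 V)} (hE : E.Finite)
    (h : edgeVec e ∉ edgeSpan E) : rank (insert e E) = rank E + 1 := by
  have := finiteDimensional_edgeSpan hE
  have hne : edgeVec e ≠ 0 := fun h0 => h (h0 ▸ Submodule.zero_mem _)
  have h1 := Submodule.finrank_sup_add_finrank_inf_eq (edgeSpan E)
    (Submodule.span (ZMod 2) {edgeVec e})
  rw [finrank_span_singleton hne,
    (Submodule.disjoint_span_singleton_of_notMem h).eq_bot, finrank_bot, add_zero] at h1
  rw [rank, edgeSpan_insert, h1, rank]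

open Classical in
theorem rank_sub_rank_sdiff [DecidableEq V] (E : Finset (Sym2 V)) (e : Sym2 V) :
    (rank (E : Set (Sym2 V)) : ℝ) - rank ((E : Set (Sym2 V)) \ {e}) =
      (if e ∈ E then 1 else 0) *
        if edgeVec e ∉ edgeSpan ((E : Set (Sym2 V)) \ {e}) then 1 else 0 := by
  by_cases he : e ∈ E
  · have hins : (E : Set (Sym2 V)) = insert e ((E : Set (Sym2 V)) \ {e}) := by
      rw [Set.insert_sdiff_singleton, Set.insert_eq_of_mem (by exact he)]
    by_cases hs : edgeVec e ∈ edgeSpan ((E : Set (Sym2 V)) \ {e})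
    · have : rank (E : Set (Sym2 V)) = rank ((E : Set (Sym2 V)) \ {e}) := by
        conv_lhs => rw [hins]
        rw [rank, edgeSpan_insert_of_mem hs, rank]
      rw [this, sub_self, if_neg (not_not.2 hs), mul_zero]
    · have : rank (E : Set (Sym2 V)) = rank ((E : Set (Sym2 V)) \ {e}) + 1 := by
        conv_lhs => rw [hins]
        exact rank_insert_of_notMem (E.finite_toSet.subset Set.sdiff_subset) hs
      rw [this, if_pos he, if_pos hs]
      push_cast
      ring
  · rw [Set.sdiff_singleton_eq_self (by exact he), sub_self, if_neg he, zero_mul]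

/-- Kruskal's algorithm: there is a forest that spans all sets of edges of bounded weight. -/
theorem exists_kruskal (E : Finset (Sym2 V)) (w : Sym2 V → ℕ) :
    ∃ F ⊆ E, LinearIndepOn (ZMod 2) edgeVec (F : Set (Sym2 V)) ∧
      ∀ i, edgeSpan {e | e ∈ E ∧ w e ≤ i} = edgeSpan {e | e ∈ F ∧ w e ≤ i} := by
  classical
  induction E using Finset.induction_on_max_value w with
  | empty => exact ⟨∅, le_rfl, by simp, fun i => by simp⟩
  | insert a E ha hmax ih =>
    obtain ⟨F, hFE, hF, hspan⟩ := ih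
    have hall : edgeSpan (E : Set (Sym2 V)) = edgeSpan (F : Set (Sym2 V)) := by
      have h1 : ∀ A : Finset (Sym2 V), A ⊆ E → {e | e ∈ A ∧ w e ≤ w a} = (A : Set (Sym2 V)) :=
        fun A hA => Set.ext fun e => ⟨fun h => h.1, fun h => ⟨h, hmax e (hA h)⟩⟩
      have h2 := hspan (w a)
      rwa [h1 E le_rfl, h1 F hFE] at h2
    have hlow : ∀ (A : Finset (Sym2 V)) (i : ℕ), ¬ w a ≤ i →
        {e | e ∈ insert a A ∧ w e ≤ i} = {e | e ∈ A ∧ w e ≤ i} := fun A i hi => by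
      ext e
      simp only [Finset.mem_insert, Set.mem_ofPred_eq]
      constructor
      · rintro ⟨rfl | h, h'⟩
        · exact absurd h' hi
        · exact ⟨h, h'⟩
      · rintro ⟨h, h'⟩
        exact ⟨Or.inr h, h'⟩
    have hhigh : ∀ (A : Finset (Sym2 V)) (i : ℕ), A ⊆ E → w a ≤ i →
        {e | e ∈ insert a A ∧ w e ≤ i} = insert a (A : Set (Sym2 V)) := fun A i hA hi => by
      ext e
      simp only [Finset.mem_insert, Set.mem_ofPred_eq, Set.mem_insert_iff, Finset.mem_coe]
      constructor
      · exact fun h => h.1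
      · rintro (rfl | h)
        · exact ⟨Or.inl rfl, hi⟩
        · exact ⟨Or.inr h, (hmax e (hA h)).trans hi⟩
    have hhigh' : ∀ i, w a ≤ i → {e | e ∈ F ∧ w e ≤ i} = (F : Set (Sym2 V)) := fun i hi =>
      Set.ext fun e => ⟨fun h => h.1, fun h => ⟨h, (hmax e (hFE h)).trans hi⟩⟩
    -- As a heaviest edge, `a` only enters the classes with i ≥ w a, which contain all of E. It
    -- joins the forest exactly if E does not span it.
    by_cases has : edgeVec a ∈ edgeSpan (E : Set (Sym2 V))
    · refine ⟨F, hFE.trans (Finset.subset_insert _ _), hF, fun i => ?_⟩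
      by_cases hi : w a ≤ i
      · rw [hhigh E i le_rfl hi, edgeSpan_insert_of_mem has, hhigh' i hi, hall]
      · rw [hlow E i hi, hspan i]
    · refine ⟨insert a F, Finset.insert_subset_insert _ hFE, ?_, fun i => ?_⟩
      · rw [Finset.coe_insert]
        exact hF.insert (by rw [hall] at has; exact has)
      · by_cases hi : w a ≤ i
        · rw [hhigh E i le_rfl hi, hhigh F i hFE hi, edgeSpan_insert, edgeSpan_insert, hall]
        · rw [hlow E i hi, hlow F i hi, hspan i]

/-- Layer-cake formula: `w e` is the number of i < W with i < `w e`. -/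
theorem sum_weight_eq (F : Finset (Sym2 V)) (w : Sym2 V → ℕ) (W : ℕ) (hW : ∀ e ∈ F, w e ≤ W) :
    (∑ e ∈ F, w e : ℝ) =
      ∑ i ∈ Finset.range W, ((F.card : ℝ) - ({e ∈ F | w e ≤ i} : Finset _).card) := by
  have h1 : ∀ i, ((F.card : ℝ) - ({e ∈ F | w e ≤ i} : Finset _).card) =
      ∑ e ∈ F, if i < w e then (1 : ℝ) else 0 := fun i => by
    rw [Finset.sum_boole, ← Finset.card_filter_add_card_filter_not (fun e => w e ≤ i) (s := F)]
    simp only [not_le]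
    push_cast
    ring
  simp only [h1]
  rw [Finset.sum_comm]
  refine Finset.sum_congr rfl fun e he => ?_
  rw [Finset.sum_boole]
  have : ({i ∈ Finset.range W | i < w e} : Finset ℕ) = Finset.range (w e) := by
    ext i
    have := hW e he
    simp only [Finset.mem_filter, Finset.mem_range]
    omega
  rw [this, Finset.card_range]

end GraphicRank

namespace WGraph

open GraphicRank

variable {V : Type u}

/-- Every spanning forest has rank E edges, and those of weight at most i are independent, hence at
most rank E_{≤ i} many. Kruskal's forest attains equality for every i. -/
theorem mstWeight_eq_sum_rank {G : WGraph V} (hdiag : ∀ e ∈ G.edges, ¬ e.IsDiag)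
    {w : Sym2 V → ℕ} (hw : ∀ e ∈ G.edges, G.weight e = w e) {W : ℕ} (hW : G.MaxWeightLE W) :
    (G.mstWeight : ℝ) = ∑ i ∈ Finset.range W, ((rank (G.edges : Set (Sym2 V)) : ℝ) -
      rank (({e ∈ G.edges | w e ≤ i} : Finset (Sym2 V)) : Set (Sym2 V))) := by
  have hsum : ∀ F ⊆ G.edges, ((∑ e ∈ F, G.weight e : ℕ) : ℝ) =
      ∑ i ∈ Finset.range W, ((F.card : ℝ) - ({e ∈ F | w e ≤ i} : Finset _).card) := by
    intro F hF
    rw [Finset.sum_congr rfl fun e he => hw e (hF he), Nat.cast_sum]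
    exact sum_weight_eq F w W fun e he => by
      rw [← hw e (hF he)]
      exact hW e (hF he)
  have hcoe : ∀ (A : Finset (Sym2 V)) (i : ℕ), (({e ∈ A | w e ≤ i} : Finset (Sym2 V)) :
      Set (Sym2 V)) = {e | e ∈ A ∧ w e ≤ i} := fun A i => by ext; simp
  have hcard : ∀ F : Finset (Sym2 V), LinearIndepOn (ZMod 2) edgeVec (F : Set (Sym2 V)) → ∀ i,
      rank (({e ∈ F | w e ≤ i} : Finset (Sym2 V)) : Set (Sym2 V)) =
        ({e ∈ F | w e ≤ i} : Finset _).card := fun F hF i =>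
    rank_eq_card (hF.mono (Finset.coe_subset.2 (Finset.filter_subset _ _)))
  have hfull : ∀ F ⊆ G.edges, G.IsSpanningForest F → rank (G.edges : Set (Sym2 V)) = F.card := by
    rintro F hF ⟨-, hac, hreach⟩
    have hind := (isAcyclic_iff_linearIndepOn fun e he => hdiag e (hF he)).1 hac
    rw [← rank_eq_card hind]
    refine le_antisymm ?_ (rank_mono G.edges.finite_toSet (by exact_mod_cast hF))
    have hle : edgeSpan (G.edges : Set (Sym2 V)) ≤ edgeSpan (F : Set (Sym2 V)) := by
      refine Submodule.span_le.2 ?_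
      rintro _ ⟨e, he, rfl⟩
      induction e using Sym2.ind with
      | _ a b =>
        refine edgeVec_mem_edgeSpan_of_reachable (hreach a b (SimpleGraph.Adj.reachable ?_))
        exact (SimpleGraph.fromEdgeSet_adj _).2
          ⟨he, fun hab => hdiag _ he (Sym2.mk_isDiag_iff.2 hab)⟩
    have := finiteDimensional_edgeSpan F.finite_toSet
    exact Submodule.finrank_mono hle
  obtain ⟨F, hF, hind, hspan⟩ := exists_kruskal G.edges w
  have hEF : edgeSpan (G.edges : Set (Sym2 V)) = edgeSpan (F : Set (Sym2 V)) := by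
    have h1 : ∀ A ⊆ G.edges, {e | e ∈ A ∧ w e ≤ W} = (A : Set (Sym2 V)) := fun A hA =>
      Set.ext fun e => ⟨fun h => h.1, fun h => ⟨h, by
        rw [← hw e (hA h)]
        exact hW e (hA h)⟩⟩
    have h2 := hspan W
    rwa [h1 _ le_rfl, h1 F hF] at h2
  have hforest : G.IsSpanningForest F := by
    refine ⟨hF, (isAcyclic_iff_linearIndepOn fun e he => hdiag e (hF he)).2 hind,
      fun a b hab => reachable_of_edgeVec_mem_edgeSpan ?_⟩
    rw [← hEF]
    exact edgeVec_mem_edgeSpan_of_reachable hab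
  have hFsum : ((∑ e ∈ F, G.weight e : ℕ) : ℝ) = ∑ i ∈ Finset.range W,
      ((rank (G.edges : Set (Sym2 V)) : ℝ) -
        rank (({e ∈ G.edges | w e ≤ i} : Finset (Sym2 V)) : Set (Sym2 V))) := by
    rw [hsum F hF]
    refine Finset.sum_congr rfl fun i _ => ?_
    have : rank (({e ∈ G.edges | w e ≤ i} : Finset (Sym2 V)) : Set (Sym2 V)) =
        rank (({e ∈ F | w e ≤ i} : Finset (Sym2 V)) : Set (Sym2 V)) := by
      rw [hcoe, hcoe, rank, rank, hspan i]
    rw [hfull F hF hforest, this, hcard F hind i]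
  rw [← hFsum]
  refine congrArg Nat.cast (le_antisymm (Nat.sInf_le ⟨F, hforest, rfl⟩)
    (le_csInf ⟨_, F, hforest, rfl⟩ ?_))
  rintro _ ⟨F', hF', rfl⟩
  have hind' := (isAcyclic_iff_linearIndepOn fun e he => hdiag e (hF'.1 he)).1 hF'.2.1
  have : ((∑ e ∈ F, G.weight e : ℕ) : ℝ) ≤ (∑ e ∈ F', G.weight e : ℕ) := by
    rw [hFsum, hsum F' hF'.1]
    refine Finset.sum_le_sum fun i _ => ?_
    rw [hfull F' hF'.1 hF', ← hcard F' hind' i]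
    have : rank (({e ∈ F' | w e ≤ i} : Finset (Sym2 V)) : Set (Sym2 V)) ≤
        rank (({e ∈ G.edges | w e ≤ i} : Finset (Sym2 V)) : Set (Sym2 V)) :=
      rank_mono (Finset.finite_toSet _)
        (Finset.coe_subset.2 (Finset.filter_subset_filter _ hF'.1))
    have : (rank (({e ∈ F' | w e ≤ i} : Finset (Sym2 V)) : Set (Sym2 V)) : ℝ) ≤
        rank (({e ∈ G.edges | w e ≤ i} : Finset (Sym2 V)) : Set (Sym2 V)) := by exact_mod_cast this
    linarith
  exact_mod_cast this

variable [DecidableEq V]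

theorem variationLE_rank {E : ℕ → Finset (Sym2 V)} (hE : Monotone E ∨ Antitone E) (e : Sym2 V) :
    VariationLE (fun t => (rank (E t : Set (Sym2 V)) : ℝ) - rank ((E t : Set (Sym2 V)) \ {e}))
      (2 + 2) := by
  classical
  simp only [rank_sub_rank_sdiff]
  refine (VariationLE.indicator (p := fun t => e ∈ E t) (hE.imp ?_ ?_)).mul
    (VariationLE.indicator (p := fun t => edgeVec e ∉ edgeSpan ((E t : Set (Sym2 V)) \ {e}))
      (hE.symm.imp ?_ ?_)) (fun t => by split_ifs <;> simp) (fun t => by split_ifs <;> simp)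
  · exact fun h s t hst he => h hst he
  · exact fun h s t hst he => h hst he
  · exact fun h s t hst he he' => he
      (edgeSpan_mono (Set.sdiff_subset_sdiff_left (Finset.coe_subset.2 (h hst))) he')
  · exact fun h s t hst he he' => he
      (edgeSpan_mono (Set.sdiff_subset_sdiff_left (Finset.coe_subset.2 (h hst))) he')

/-- Each of the W thresholds contributes two rank effects of variation 4. -/
theorem edgeVariationLE_mstWeight {Q : WGraph V → Prop} {W : ℕ} (hQ : ∀ G, Q G → G.MaxWeightLE W) :
    EdgeVariationLE Q (fun G : WGraph V => (G.mstWeight : ℝ)) (8 * W) := by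
  intro G hG hQG e
  obtain ⟨w, hw⟩ := hG.exists_weight
  have hG' := hG.eraseEdges {e}
  have hE : Monotone (fun t => (G t).edges) ∨ Antitone (fun t => (G t).edges) :=
    hG.monotone_or_antitone.imp And.right And.right
  have hw' : ∀ t, ∀ e' ∈ ((G t).eraseEdges {e}).edges,
      ((G t).eraseEdges {e}).weight e' = w e' := fun t e' he' => by
    have h := Finset.mem_sdiff.1 he'
    simp only [WGraph.eraseEdges, if_neg h.2]
    exact hw t e' h.1
  have key : ∀ t, ((G t).mstWeight : ℝ) - ((G t).eraseEdges {e}).mstWeight =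
      ∑ i ∈ Finset.range W,
        (((rank ((G t).edges : Set (Sym2 V)) : ℝ) - rank (((G t).edges : Set (Sym2 V)) \ {e})) -
        ((rank (({e ∈ (G t).edges | w e ≤ i} : Finset (Sym2 V)) : Set (Sym2 V)) : ℝ) -
          rank ((({e ∈ (G t).edges | w e ≤ i} : Finset (Sym2 V)) : Set (Sym2 V)) \ {e}))) := by
    intro t
    rw [mstWeight_eq_sum_rank (hG.not_isDiag t) (hw t) (hQ _ (hQG t)),
      mstWeight_eq_sum_rank (hG'.not_isDiag t) (hw' t)
        (hereditaryEdges_maxWeightLE W _ _ (hQ _ (hQG t))), ← Finset.sum_sub_distrib]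
    refine Finset.sum_congr rfl fun i _ => ?_
    have h1 : (((G t).eraseEdges {e}).edges : Set (Sym2 V)) =
        ((G t).edges : Set (Sym2 V)) \ {e} := by simp [WGraph.eraseEdges]
    have h2 : (({e' ∈ ((G t).eraseEdges {e}).edges | w e' ≤ i} : Finset (Sym2 V)) :
        Set (Sym2 V)) =
        (({e ∈ (G t).edges | w e ≤ i} : Finset (Sym2 V)) : Set (Sym2 V)) \ {e} := by
      ext e'
      simp [WGraph.eraseEdges]
      tauto
    rw [h1, h2]
    ring
  simp only [key]
  refine (VariationLE.sum (Finset.range W) (C := fun _ => (2 + 2) + (2 + 2)) fun i _ =>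
    (variationLE_rank hE e).sub (variationLE_rank (hE.imp ?_ ?_) e)).mono ?_
  · exact fun h s t hst => Finset.filter_subset_filter _ (h hst)
  · exact fun h s t hst => Finset.filter_subset_filter _ (h hst)
  · rw [Finset.sum_const, Finset.card_range, nsmul_eq_mul]
    linarith

theorem isolatedVariationLE_mstWeight {Q : WGraph V → Prop} {W : ℕ}
    (hQ : ∀ G, Q G → G.MaxWeightLE W) :
    IsolatedVariationLE Q (fun G : WGraph V => (G.mstWeight : ℝ)) 0 := by
  intro G hG hQG x hx
  obtain ⟨w, hw⟩ := hG.exists_weight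
  have h : ∀ t, (((G t).eraseVert x).mstWeight : ℝ) = (G t).mstWeight := by
    intro t
    have hwt : ∀ e ∈ (G t).edges, ((G t).eraseVert x).weight e = w e := fun e he => by
      have hxe : x ∉ e := fun h => by
        have : e ∈ (G t).incident x := Finset.mem_filter.2 ⟨he, h⟩
        simp [hx t] at this
      simp only [eraseVert, if_neg hxe]
      exact hw t e he
    rw [mstWeight_eq_sum_rank (hG.not_isDiag t) (hw t) (hQ _ (hQG t)),
      mstWeight_eq_sum_rank (w := w) (W := W), eraseVert_edges (hx t)]
    · rw [eraseVert_edges (hx t)]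
      exact hG.not_isDiag t
    · rw [eraseVert_edges (hx t)]
      exact hwt
    · intro e he
      rw [eraseVert_edges (hx t)] at he
      rw [hwt e he, ← hw t e he]
      exact hQ _ (hQG t) e he
  simpa [h] using VariationLE.zero

end WGraph

/-! ### Private algorithms for graph functions -/

section Algorithms

variable {V : Type u} [DecidableEq V] {T : ℕ}

theorem GraphSeq.DegreeLE.maxDegreeLE {S : GraphSeq V T} {D : ℕ} (h : S.DegreeLE D) (i : Fin T) :
    (S.graph i.succ).MaxDegreeLE D := h i

theorem GraphSeq.WeightLE.maxWeightLE {S : GraphSeq V T} {W : ℕ} (h : S.WeightLE W) (i : Fin T) :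
    (S.graph i.succ).MaxWeightLE W := fun e he => by
  have he' : e ∈ S.edges i.succ := he
  simp only [GraphSeq.graph, if_pos he']
  exact (h i e he').2

variable {ε δ : ℝ} {Q : GraphSeq V T → Prop} {R : WGraph V → Prop} {B Γ : ℝ}

/-- The factor 100 leaves room for the numerical constants of all graph functions, so that one
constant 300 · 100 serves the whole table. -/
theorem hasPrivateAlgorithm_edge (hT : 2 ≤ T) (hε : 0 < ε) (hδ : 0 < δ)
    (hQ : ∀ S, Q S → ∀ i : Fin T, R (S.graph i.succ)) {ι : Type} [Fintype ι]
    {f : WGraph V → ι → ℝ} (hf : ∀ j, WGraph.EdgeVariationLE R (fun G => f G j) B)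
    (hΓ : 0 < Γ) (hB : Fintype.card ι * (B + B) ≤ 100 * Γ) :
    HasPrivateAlgorithm Q GraphSeq.EdgeAdj f ε δ (30000 * (Γ * baseError T ε δ)) := by
  have h := hasPrivateAlgorithm_of_variationLE (f := f) hT hε hδ (Q := Q)
    (Adj := GraphSeq.EdgeAdj) (Γ := 100 * Γ)
    (by positivity) fun S S' hS hS' hQS hQS' hadj => ⟨fun _ => B + B, fun j =>
      GraphSeq.EdgeAdj.variationLE hadj hS hS'
        (GraphSeq.graphAt_of_forall_succ (by omega) (hQ S hQS))
        (GraphSeq.graphAt_of_forall_succ (by omega) (hQ S' hQS')) (hf j), by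
      rwa [Finset.sum_const, Finset.card_univ, nsmul_eq_mul]⟩
  convert! h using 1
  ring

theorem hasPrivateAlgorithm_node (hT : 2 ≤ T) (hε : 0 < ε) (hδ : 0 < δ)
    (hQ : ∀ S, Q S → ∀ i : Fin T, R (S.graph i.succ)) {ι : Type} [Fintype ι]
    {f : WGraph V → ι → ℝ} (hf : ∀ j, WGraph.NodeVariationLE R (fun G => f G j) B)
    (hΓ : 0 < Γ) (hB : Fintype.card ι * (B + B) ≤ 100 * Γ) :
    HasPrivateAlgorithm Q GraphSeq.NodeAdj f ε δ (30000 * (Γ * baseError T ε δ)) := by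
  have h := hasPrivateAlgorithm_of_variationLE (f := f) hT hε hδ (Q := Q)
    (Adj := GraphSeq.NodeAdj) (Γ := 100 * Γ)
    (by positivity) fun S S' hS hS' hQS hQS' hadj => ⟨fun _ => B + B, fun j =>
      GraphSeq.NodeAdj.variationLE hadj hS hS'
        (GraphSeq.graphAt_of_forall_succ (by omega) (hQ S hQS))
        (GraphSeq.graphAt_of_forall_succ (by omega) (hQ S' hQS')) (hf j), by
      rwa [Finset.sum_const, Finset.card_univ, nsmul_eq_mul]⟩
  convert! h using 1
  ring

namespace WGraph

theorem edgeVariationLE_degreeBin (j : ℕ) :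
    EdgeVariationLE R (fun G : WGraph V => (G.degreeBin j : ℝ)) (8 + 8) := by
  intro G hG hR e
  have h := (edgeVariationLE_highDegreeCount j G hG hR e).sub
    (edgeVariationLE_highDegreeCount (j + 1) G hG hR e)
  simp only [degreeBin_eq_sub]
  convert! h using 2 with t
  ring

theorem isolatedVariationLE_degreeBin (j : ℕ) :
    IsolatedVariationLE R (fun G : WGraph V => (G.degreeBin j : ℝ)) (2 + 2) := by
  intro G hG hR x hx
  have h := (isolatedVariationLE_highDegreeCount j G hG hR x hx).sub
    (isolatedVariationLE_highDegreeCount (j + 1) G hG hR x hx)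
  simp only [degreeBin_eq_sub]
  convert! h using 2 with t
  ring

/-- For k ≥ 1, up to D edges cost 4D ^ (k - 1) each and the isolated node at most 2. For k = 0 only
nodes are counted and edges have no effect. -/
theorem nodeVariationLE_kStarCount {D : ℕ} (hD : 1 ≤ D) (k : ℕ) :
    NodeVariationLE (MaxDegreeLE D) (fun G : WGraph V => (G.kStarCount k : ℝ)) (6 * D ^ k) := by
  have hD' : (1 : ℝ) ≤ D := by exact_mod_cast hD
  intro G hG hR x
  cases k with
  | zero =>
    refine (edgeVariationLE_kStarCount_zero.nodeVariationLE (isolatedVariationLE_kStarCount 0)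
      (hereditaryEdges_maxDegreeLE D) (fun _ h => h) le_rfl G hG hR x).mono ?_
    norm_num
  | succ k =>
    refine ((edgeVariationLE_kStarCount_succ D k).nodeVariationLE
      (isolatedVariationLE_kStarCount (k + 1)) (hereditaryEdges_maxDegreeLE D) (fun _ h => h)
      (by positivity) G hG hR x).mono ?_
    have : (1 : ℝ) ≤ D ^ (k + 1) := one_le_pow₀ hD'
    have h2 : (D : ℝ) * (4 * D ^ k) = 4 * D ^ (k + 1) := by ring
    linarith

theorem edgeVariationLE_kStarCount {D : ℕ} (hD : 1 ≤ D) (k : ℕ) :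
    EdgeVariationLE (MaxDegreeLE D) (fun G : WGraph V => (G.kStarCount k : ℝ)) (4 * D ^ k) := by
  intro G hG hR e
  cases k with
  | zero => exact (edgeVariationLE_kStarCount_zero G hG hR e).mono (by positivity)
  | succ k =>
    refine (edgeVariationLE_kStarCount_succ D k G hG hR e).mono ?_
    have hD' : (1 : ℝ) ≤ D := by exact_mod_cast hD
    gcongr
    · exact k.le_succ

end WGraph

end Algorithms

/-! ### Assembly of the table -/

theorem theorem1 :
    ∃ C : ℝ, 0 < C ∧
      ∀ (V : Type u) [DecidableEq V] (T : ℕ), 2 ≤ T →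
      ∀ ε δ : ℝ, 0 < ε → 0 < δ →
      ∀ D W : ℕ, 1 ≤ D → 1 ≤ W →
      ∀ τ k : ℕ,
        -- minimum spanning tree
        (HasPrivateAlgorithm (V := V) (T := T) (fun S => S.WeightLE W) GraphSeq.EdgeAdj
            (scalar WGraph.mstWeight) ε δ (C * (W * baseError T ε δ)) ∧
          HasPrivateAlgorithm (V := V) (T := T) (fun S => S.DegreeLE D ∧ S.WeightLE W)
            GraphSeq.NodeAdj (scalar WGraph.mstWeight) ε δ (C * (D * W * baseError T ε δ))) ∧
        -- edge count
        (HasPrivateAlgorithm (V := V) (T := T) (fun _ => True) GraphSeq.EdgeAdj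
            (scalar WGraph.edgeCount) ε δ (C * baseError T ε δ) ∧
          HasPrivateAlgorithm (V := V) (T := T) (fun S => S.DegreeLE D) GraphSeq.NodeAdj
            (scalar WGraph.edgeCount) ε δ (C * (D * baseError T ε δ))) ∧
        -- number of nodes of degree at least `τ`
        (HasPrivateAlgorithm (V := V) (T := T) (fun _ => True) GraphSeq.EdgeAdj
            (scalar (WGraph.highDegreeCount τ)) ε δ (C * baseError T ε δ) ∧
          HasPrivateAlgorithm (V := V) (T := T) (fun S => S.DegreeLE D) GraphSeq.NodeAdj
            (scalar (WGraph.highDegreeCount τ)) ε δ (C * (D * baseError T ε δ))) ∧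
        -- degree histogram
        (HasPrivateAlgorithm (V := V) (T := T) (fun S => S.DegreeLE D) GraphSeq.EdgeAdj
            (degreeHistogram D) ε δ (C * (D * baseError T ε δ)) ∧
          HasPrivateAlgorithm (V := V) (T := T) (fun S => S.DegreeLE D) GraphSeq.NodeAdj
            (degreeHistogram D) ε δ (C * (D ^ 2 * baseError T ε δ))) ∧
        -- triangle count
        (HasPrivateAlgorithm (V := V) (T := T) (fun S => S.DegreeLE D) GraphSeq.EdgeAdj
            (scalar WGraph.triangleCount) ε δ (C * (D * baseError T ε δ)) ∧
          HasPrivateAlgorithm (V := V) (T := T) (fun S => S.DegreeLE D) GraphSeq.NodeAdj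
            (scalar WGraph.triangleCount) ε δ (C * (D ^ 2 * baseError T ε δ))) ∧
        -- `k`-star count
        (HasPrivateAlgorithm (V := V) (T := T) (fun S => S.DegreeLE D) GraphSeq.EdgeAdj
            (scalar (WGraph.kStarCount k)) ε δ (C * (D ^ k * baseError T ε δ)) ∧
          HasPrivateAlgorithm (V := V) (T := T) (fun S => S.DegreeLE D) GraphSeq.NodeAdj
            (scalar (WGraph.kStarCount k)) ε δ (C * (D ^ k * baseError T ε δ))) := by
  refine ⟨30000, by norm_num, ?_⟩
  intro V _ T hT ε δ hε hδ D W hD hW τ k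
  have hD' : (1 : ℝ) ≤ D := by exact_mod_cast hD
  have hW' : (1 : ℝ) ≤ W := by exact_mod_cast hW
  have hDh := WGraph.hereditaryEdges_maxDegreeLE (V := V) D
  have hQD : ∀ S : GraphSeq V T, S.DegreeLE D → ∀ i : Fin T, (S.graph i.succ).MaxDegreeLE D :=
    fun S h => h.maxDegreeLE
  have hDD : (D : ℝ) ≤ D ^ 2 := by nlinarith
  have hunit : (Fintype.card Unit : ℝ) = 1 := by simp
  have hfin : (Fintype.card (Fin (D + 1)) : ℝ) = D + 1 := by simp
  refine ⟨⟨?_, ?_⟩, ⟨?_, ?_⟩, ⟨?_, ?_⟩, ⟨?_, ?_⟩, ⟨?_, ?_⟩, ⟨?_, ?_⟩⟩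
  · refine hasPrivateAlgorithm_edge hT hε hδ (R := WGraph.MaxWeightLE W) (fun S h => h.maxWeightLE)
      (fun _ => WGraph.edgeVariationLE_mstWeight fun _ h => h) (by linarith) ?_
    rw [hunit]
    linarith
  · refine hasPrivateAlgorithm_node hT hε hδ
      (R := fun G => WGraph.MaxDegreeLE D G ∧ WGraph.MaxWeightLE W G)
      (fun S h i => ⟨h.1.maxDegreeLE i, h.2.maxWeightLE i⟩)
      (fun _ => (WGraph.edgeVariationLE_mstWeight fun _ h => h.2).nodeVariationLE
        (WGraph.isolatedVariationLE_mstWeight fun _ h => h.2)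
        (fun G X h => ⟨hDh G X h.1, WGraph.hereditaryEdges_maxWeightLE W G X h.2⟩)
        (fun _ h => h.1) (by positivity)) (by positivity) ?_
    rw [hunit]
    nlinarith
  · rw [← one_mul (baseError T ε δ)]
    refine hasPrivateAlgorithm_edge hT hε hδ (R := fun _ => True) (fun _ _ _ => trivial)
      (fun _ => WGraph.edgeVariationLE_edgeCount) one_pos ?_
    rw [hunit]
    norm_num
  · refine hasPrivateAlgorithm_node hT hε hδ hQD
      (fun _ => WGraph.edgeVariationLE_edgeCount.nodeVariationLE
        WGraph.isolatedVariationLE_edgeCount hDh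
        (fun _ h => h) (by norm_num)) (by linarith) ?_
    rw [hunit]
    linarith
  · rw [← one_mul (baseError T ε δ)]
    refine hasPrivateAlgorithm_edge hT hε hδ (R := fun _ => True) (fun _ _ _ => trivial)
      (fun _ => WGraph.edgeVariationLE_highDegreeCount τ) one_pos ?_
    rw [hunit]
    norm_num
  · refine hasPrivateAlgorithm_node hT hε hδ hQD
      (fun _ => (WGraph.edgeVariationLE_highDegreeCount τ).nodeVariationLE
        (WGraph.isolatedVariationLE_highDegreeCount τ) hDh (fun _ h => h) (by norm_num))
      (by linarith) ?_
    rw [hunit]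
    linarith
  · refine hasPrivateAlgorithm_edge hT hε hδ hQD
      (fun j => WGraph.edgeVariationLE_degreeBin (j : ℕ)) (by linarith) ?_
    -- There are D + 1 bins of variation 16 + 16 each, and 32(D + 1) ≤ 64D.
    rw [hfin]
    linarith
  · refine hasPrivateAlgorithm_node hT hε hδ hQD
      (fun j => (WGraph.edgeVariationLE_degreeBin (j : ℕ)).nodeVariationLE
        (WGraph.isolatedVariationLE_degreeBin j) hDh (fun _ h => h) (by norm_num)) (by positivity) ?_
    -- Here the total is 2(D + 1)(16D + 4) ≤ 80D².
    rw [hfin]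
    nlinarith
  · refine hasPrivateAlgorithm_edge hT hε hδ hQD
      (fun _ => WGraph.edgeVariationLE_triangleCount D) (by linarith) ?_
    rw [hunit]
    linarith
  · refine hasPrivateAlgorithm_node hT hε hδ hQD
      (fun _ => (WGraph.edgeVariationLE_triangleCount D).nodeVariationLE
        WGraph.isolatedVariationLE_triangleCount hDh (fun _ h => h) (by positivity))
      (by positivity) ?_
    rw [hunit]
    nlinarith
  · refine hasPrivateAlgorithm_edge hT hε hδ hQD
      (fun _ => WGraph.edgeVariationLE_kStarCount hD k) (by positivity) ?_
    rw [hunit]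
    have : (0 : ℝ) ≤ D ^ k := by positivity
    linarith
  · refine hasPrivateAlgorithm_node hT hε hδ hQD
      (fun _ => WGraph.nodeVariationLE_kStarCount hD k) (by positivity) ?_
    rw [hunit]
    have : (0 : ℝ) ≤ D ^ k := by positivity
    linarith
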